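/- **Semirings.** Let $\mathcal G$ be the commutative semiring of isomorphism classes of finite simple graphs, with addition the disjoint union $\sqcup$, multiplication the strong product $\boxtimes$, zero the empty graph $K_0$ and unit the one-vertex graph $K_1$. An *nc-graph* is a linear subspace $S\subseteq\mathcal L(A)$, with $A$ a finite-dimensional complex Hilbert space, such that $S^\dagger=S$ and $I_A\in S$; two nc-graphs $S_1,S_2$ are isomorphic if $S_2=U^\dagger S_1U$ for some unitary $U$. Let $\mathcal S$ be the commutative semiring of isomorphism classes of nc-graphs, with addition the direct sum $S_1\oplus S_2\subseteq\mathcal L(A_1\oplus A_2)$ (block-diagonal operators), multiplication the tensor product $S_1\otimes S_2=\mathrm{span}\{X\otimes Y: X\in S_1, Y\in S_2\}\subseteq\mathcal L(A_1\otimes A_2)$, zero the nc-graph on the zero space and unit $\mathcal L(\mathbb C)$. For a graph $G$ let $$S_G=\mathrm{span}\{|g\rangle\langle g'| : g=g'\text{ or }\{g,g'\}\in E(G)\}\subseteq\mathcal L(\mathbb C^{V(G)}).$$ The map $\iota:\mathcal G\to\mathcal S$, $G\mapsto S_G$, is a semiring homomorphism. **Preorders.** For graphs $G,H$ write $G\le_*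 H$ if there are $d\in\mathbb N$ and positive semidefinite matrices $\rho\neq0$ and $\rho_g^h$ ($g\in V(G)$, $h\in V(H)$) in $M(d,\mathbb C)$ such that $\sum_{h}\rho_g^h=\rho$ for every $g$, and $\rho_g^h\rho_{g'}^{h'}=0$ whenever $g\ne g'$, $\{g,g'\}\notin E(G)$, and either $h=h'$ or $\{h,h'\}\in E(H)$. For nc-graphs $S\subseteq\mathcal L(A)$ and $T\subseteq\mathcal L(B)$ write $S\le_* T$ if there are a finite-dimensional Hilbert space $A_0$, a positive definite $\rho\in\mathcal L(A_0)$ with $\mathrm{Tr}\,\rho=1$, and finitely many operators $E_i:A\otimes A_0\to B$ with $\sum_iE_i^\dagger E_i=I$, such that $E_i(X\otimes\rho)E_j^\dagger$ is orthogonal to $T$ for all $i,j$ and all $X\in\mathcal L(A)$ orthogonal to $S$ (orthogonality with respect to $\langle X,Y\rangle=\mathrm{Tr}(X^\dagger Y)$). Both relations are well defined on isomorphism classes. **Asymptotic spectra.** For $\mathcal R\in\{\mathcal G,\mathcal S\}$ let $\mathbf X(\mathcal R,\le_*)$ be the set of semiring homomorphisms $\phi:\mathcal R\to\mathbb R_{\ge0}$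 such that $a\le_* b$ implies $\phi(a)\le\phi(b)$ for all $a,b\in\mathcal R$. **Theorem.** The map $\mathbf X(\mathcal S,\le_*)\to\mathbf X(\mathcal G,\le_*)$, $\phi\mapsto\phi\circ\iota$, is well defined and surjective. In other words, $\phi\circ\iota\in\mathbf X(\mathcal G,\le_*)$ for every $\phi\in\mathbf X(\mathcal S,\le_*)$, and every $\psi\in\mathbf X(\mathcal G,\le_*)$ is of the form $\phi\circ\iota$ for some $\phi\in\mathbf X(\mathcal S,\le_*)$. -/

import Mathlib

open scoped Matrix Kronecker ComplexOrder NNReal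

/-! ## Asymptotic spectra -/

/-- The asymptotic spectrum of a commutative semiring `R` with respect to a relation `le`:
the set of `le`-monotone semiring homomorphisms from `R` to the nonnegative reals. -/
def asymptoticSpectrum (R : Type*) [CommSemiring R] (le : R → R → Prop) : Set (R →+* ℝ≥0) :=
  {φ | ∀ a b : R, le a b → φ a ≤ φ b}

/-! ## Graphs -/

/-- Finite simple graphs. -/
structure FinGraph where
  V : Type
  [fintypeV : Fintype V]
  [decEqV : DecidableEq V]
  graph : SimpleGraph V

attribute [instance] FinGraph.fintypeV FinGraph.decEqV

namespace FinGraph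

/-- The strong product of two simple graphs. -/
def strongProd {V W : Type} (G : SimpleGraph V) (H : SimpleGraph W) : SimpleGraph (V × W) where
  Adj p q := (p.1 = q.1 ∧ H.Adj p.2 q.2) ∨ (G.Adj p.1 q.1 ∧ H.Adj p.2 q.2) ∨
    (G.Adj p.1 q.1 ∧ p.2 = q.2)
  symm := ⟨fun p q h => by
    rcases h with ⟨h1, h2⟩ | ⟨h1, h2⟩ | ⟨h1, h2⟩
    · exact Or.inl ⟨h1.symm, h2.symm⟩
    · exact Or.inr (Or.inl ⟨h1.symm, h2.symm⟩)
    · exact Or.inr (Or.inr ⟨h1.symm, h2.symm⟩)⟩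
  loopless := ⟨fun p h => by
    rcases h with ⟨_, h⟩ | ⟨h, _⟩ | ⟨h, _⟩ <;> exact h.ne rfl⟩

/-- The edgeless graph on `n` vertices, that is the complement of the complete graph `K_n`. -/
abbrev edgeless (n : ℕ) : FinGraph := ⟨Fin n, ⊥⟩

/-- Disjoint union of graphs. -/
abbrev disjUnion (G H : FinGraph) : FinGraph := ⟨G.V ⊕ H.V, G.graph ⊕g H.graph⟩

/-- Strong product of graphs. -/
abbrev strong (G H : FinGraph) : FinGraph := ⟨G.V × H.V, strongProd G.graph H.graph⟩

/-- Entanglement-assisted homomorphism from `G` to `H`; the operator `ρ` has to be nonzero. -/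
def EAHom {V W : Type} [Fintype W] (G : SimpleGraph V) (H : SimpleGraph W) : Prop :=
  ∃ (d : ℕ) (ρ : Matrix (Fin d) (Fin d) ℂ) (σ : V → W → Matrix (Fin d) (Fin d) ℂ),
    ρ.PosSemidef ∧ ρ ≠ 0 ∧ (∀ g h, (σ g h).PosSemidef) ∧
    (∀ g, ∑ h, σ g h = ρ) ∧
    ∀ g g' h h', G.Adj g g' → ¬ H.Adj h h' → σ g h * σ g' h' = 0

/-- The entanglement-assisted cohomomorphism preorder on graphs. -/
def EALe (G H : FinGraph) : Prop := EAHom (G.graph)ᶜ (H.graph)ᶜ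

instance setoid : Setoid FinGraph where
  r G H := Nonempty (G.graph ≃g H.graph)
  iseqv := ⟨fun _ => ⟨RelIso.refl _⟩, fun ⟨e⟩ => ⟨e.symm⟩, fun ⟨e⟩ ⟨f⟩ => ⟨e.trans f⟩⟩

theorem disjUnion_congr {G G' H H' : FinGraph} (h₁ : G ≈ G') (h₂ : H ≈ H') :
    disjUnion G H ≈ disjUnion G' H' := by
  obtain ⟨e⟩ := h₁
  obtain ⟨f⟩ := h₂
  exact ⟨SimpleGraph.Iso.sumCongr e f⟩

/-- Strong products of isomorphic graphs are isomorphic. -/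
def strongIso {V V' W W' : Type} {G : SimpleGraph V} {G' : SimpleGraph V'} {H : SimpleGraph W}
    {H' : SimpleGraph W'} (e : G ≃g G') (f : H ≃g H') : strongProd G H ≃g strongProd G' H' where
  toEquiv := e.toEquiv.prodCongr f.toEquiv
  map_rel_iff' := by
    rintro ⟨a, b⟩ ⟨c, d⟩
    have he : G'.Adj (e a) (e c) ↔ G.Adj a c := e.map_rel_iff'
    have hf : H'.Adj (f b) (f d) ↔ H.Adj b d := f.map_rel_iff'
    simp [strongProd, he, hf]

theorem strong_congr {G G' H H' : FinGraph} (h₁ : G ≈ G') (h₂ : H ≈ H') :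
    strong G H ≈ strong G' H' := by
  obtain ⟨e⟩ := h₁
  obtain ⟨f⟩ := h₂
  exact ⟨strongIso e f⟩

theorem EALe_of_equiv {G G' H H' : FinGraph} (h₁ : G ≈ G') (h₂ : H ≈ H') (h : EALe G H) :
    EALe G' H' := by
  obtain ⟨e⟩ := h₁
  obtain ⟨f⟩ := h₂
  obtain ⟨d, ρ, σ, hρ, hρ0, hσ, hsum, horth⟩ := h
  refine ⟨d, ρ, fun g h => σ (e.symm g) (f.symm h), hρ, hρ0, fun _ _ => hσ _ _, fun g => ?_, ?_⟩
  · rw [← hsum (e.symm g)]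
    exact Equiv.sum_comp f.symm.toEquiv (fun h => σ (e.symm g) h)
  · intro g g' h h' hg hh
    apply horth
    · rw [SimpleGraph.compl_adj] at hg ⊢
      exact ⟨fun hc => hg.1 (e.symm.injective hc), fun hc => hg.2 (e.symm.map_rel_iff'.1 hc)⟩
    · rw [SimpleGraph.compl_adj] at hh ⊢
      exact fun hc => hh ⟨fun hc' => hc.1 (congrArg _ hc'),
        fun hc' => hc.2 (f.symm.map_rel_iff'.2 hc')⟩

end FinGraph

/-- Isomorphism classes of finite simple graphs. -/
def GraphClass : Type 1 := Quotient FinGraph.setoid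

namespace GraphClass

open FinGraph

/-- Disjoint union of isomorphism classes. -/
def add : GraphClass → GraphClass → GraphClass :=
  Quotient.map₂ disjUnion fun _ _ h₁ _ _ h₂ => disjUnion_congr h₁ h₂

/-- Strong product of isomorphism classes. -/
def mul : GraphClass → GraphClass → GraphClass :=
  Quotient.map₂ strong fun _ _ h₁ _ _ h₂ => strong_congr h₁ h₂

theorem strong_comm (G H : FinGraph) : strong G H ≈ strong H G := by
  refine ⟨⟨Equiv.prodComm _ _, ?_⟩⟩
  rintro ⟨a, b⟩ ⟨c, d⟩
  simp [strong, strongProd]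
  tauto

theorem zero_strong (G : FinGraph) : strong (edgeless 0) G ≈ edgeless 0 := by
  have : IsEmpty (strong (edgeless 0) G).V := ⟨fun p => Fin.elim0 p.1⟩
  have : IsEmpty (edgeless 0).V := ⟨fun p => Fin.elim0 p⟩
  exact ⟨⟨Equiv.equivOfIsEmpty _ _, fun {a} => isEmptyElim a⟩⟩

theorem one_strong (G : FinGraph) : strong (edgeless 1) G ≈ G := by
  refine ⟨⟨Equiv.uniqueProd _ (Fin 1), ?_⟩⟩
  rintro ⟨a, b⟩ ⟨c, d⟩
  have : a = c := Subsingleton.elim (α := Fin 1) a c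
  subst this
  change G.graph.Adj b d ↔ _
  simp [strongProd]

theorem strong_add (G H K : FinGraph) :
    strong G (disjUnion H K) ≈ disjUnion (strong G H) (strong G K) := by
  refine ⟨⟨Equiv.prodSumDistrib _ _ _, ?_⟩⟩
  rintro ⟨a, b | b⟩ ⟨c, d | d⟩ 
  · change (strongProd G.graph H.graph).Adj (a, b) (c, d) ↔ _
    simp [strongProd]
  · change (false = true) ↔ _
    simp [strongProd]
  · change (false = true) ↔ _
    simp [strongProd]
  · change (strongProd G.graph K.graph).Adj (a, b) (c, d) ↔ _
    simp [strongProd]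

theorem strong_assoc (G H K : FinGraph) : strong (strong G H) K ≈ strong G (strong H K) := by
  refine ⟨⟨Equiv.prodAssoc _ _ _, ?_⟩⟩
  rintro ⟨⟨a, b⟩, c⟩ ⟨⟨a', b'⟩, c'⟩
  change (strongProd G.graph (strongProd H.graph K.graph)).Adj (a, b, c) (a', b', c') ↔ _
  simp only [strongProd, Prod.mk.injEq]
  tauto

theorem zero_disjUnion (G : FinGraph) : disjUnion (edgeless 0) G ≈ G := by
  refine ⟨⟨Equiv.emptySum (Fin 0) _, ?_⟩⟩
  rintro (a | a) (b | b)
  · exact Fin.elim0 a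
  · exact Fin.elim0 a
  · exact Fin.elim0 b
  · change G.graph.Adj a b ↔ _
    simp

theorem mul_comm' (a b : GraphClass) : mul a b = mul b a :=
  Quotient.inductionOn₂ a b fun G H => Quotient.sound (strong_comm G H)

theorem add_comm' (a b : GraphClass) : add a b = add b a :=
  Quotient.inductionOn₂ a b fun _ _ => Quotient.sound ⟨SimpleGraph.Iso.sumComm⟩

theorem zero_add' (a : GraphClass) : add (Quotient.mk _ (edgeless 0)) a = a :=
  Quotient.inductionOn a fun G => Quotient.sound (zero_disjUnion G)

theorem zero_mul' (a : GraphClass) :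
    mul (Quotient.mk _ (edgeless 0)) a = Quotient.mk _ (edgeless 0) :=
  Quotient.inductionOn a fun G => Quotient.sound (zero_strong G)

theorem one_mul' (a : GraphClass) : mul (Quotient.mk _ (edgeless 1)) a = a :=
  Quotient.inductionOn a fun G => Quotient.sound (one_strong G)

theorem mul_add' (a b c : GraphClass) : mul a (add b c) = add (mul a b) (mul a c) :=
  Quotient.inductionOn₃ a b c fun G H K => Quotient.sound (strong_add G H K)

/-- The semiring of graphs: disjoint union, strong product, `K_0` and `K_1`. -/
instance commSemiring : CommSemiring GraphClass where
  add := add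
  mul := mul
  zero := Quotient.mk _ (edgeless 0)
  one := Quotient.mk _ (edgeless 1)
  nsmul := @nsmulRec _ ⟨Quotient.mk _ (edgeless 0)⟩ ⟨add⟩
  add_assoc a b c := Quotient.inductionOn₃ a b c fun _ _ _ =>
    Quotient.sound ⟨SimpleGraph.Iso.sumAssoc⟩
  add_comm := add_comm'
  zero_add := zero_add'
  add_zero a := (add_comm' _ _).trans (zero_add' a)
  mul_assoc a b c := Quotient.inductionOn₃ a b c fun G H K => Quotient.sound (strong_assoc G H K)
  mul_comm := mul_comm'
  one_mul := one_mul'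
  mul_one a := (mul_comm' _ _).trans (one_mul' a)
  zero_mul := zero_mul'
  mul_zero a := (mul_comm' _ _).trans (zero_mul' a)
  left_distrib := mul_add'
  right_distrib a b c := by
    change mul (add a b) c = add (mul a c) (mul b c)
    rw [mul_comm', mul_add', mul_comm' c a, mul_comm' c b]

/-- The entanglement-assisted cohomomorphism preorder on isomorphism classes of graphs. -/
def EALe : GraphClass → GraphClass → Prop :=
  Quotient.lift₂ FinGraph.EALe fun _ _ _ _ h₁ h₂ => propext
    ⟨EALe_of_equiv h₁ h₂, EALe_of_equiv (Setoid.symm h₁) (Setoid.symm h₂)⟩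

end GraphClass

/-! ## Non-commutative graphs -/

/-- Non-commutative graphs: self-adjoint spaces of operators on a finite-dimensional Hilbert space
(with a chosen orthonormal basis indexed by `Idx`) that contain the identity. -/
structure NCGraph where
  Idx : Type
  [fintypeIdx : Fintype Idx]
  [decEqIdx : DecidableEq Idx]
  space : Submodule ℂ (Matrix Idx Idx ℂ)
  conjTranspose_mem : ∀ X ∈ space, Xᴴ ∈ space
  one_mem : 1 ∈ space

attribute [instance] NCGraph.fintypeIdx NCGraph.decEqIdx

namespace NCGraph

/-- Orthogonality for the Hilbert-Schmidt inner product. -/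
def HSOrth {m n : Type} [Fintype m] [Fintype n] (A B : Matrix m n ℂ) : Prop :=
  (Aᴴ * B).trace = 0

/-- Direct sum of operator spaces, as block diagonal operators. -/
def sumSpace {I J : Type} (S : Submodule ℂ (Matrix I I ℂ)) (T : Submodule ℂ (Matrix J J ℂ)) :
    Submodule ℂ (Matrix (I ⊕ J) (I ⊕ J) ℂ) where
  carrier := {Z | ∃ X ∈ S, ∃ Y ∈ T, Z = Matrix.fromBlocks X 0 0 Y}
  zero_mem' := ⟨0, S.zero_mem, 0, T.zero_mem, by simp⟩
  add_mem' := by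
    rintro _ _ ⟨X, hX, Y, hY, rfl⟩ ⟨X', hX', Y', hY', rfl⟩
    exact ⟨X + X', S.add_mem hX hX', Y + Y', T.add_mem hY hY', by simp [Matrix.fromBlocks_add]⟩
  smul_mem' := by
    rintro c _ ⟨X, hX, Y, hY, rfl⟩
    exact ⟨c • X, S.smul_mem c hX, c • Y, T.smul_mem c hY, by simp [Matrix.fromBlocks_smul]⟩

theorem mem_sumSpace {I J : Type} {S : Submodule ℂ (Matrix I I ℂ)}
    {T : Submodule ℂ (Matrix J J ℂ)} {Z : Matrix (I ⊕ J) (I ⊕ J) ℂ} :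
    Z ∈ sumSpace S T ↔ ∃ X ∈ S, ∃ Y ∈ T, Z = Matrix.fromBlocks X 0 0 Y := Iff.rfl

/-- Tensor product of operator spaces. -/
def tensorSpace {I J : Type} (S : Submodule ℂ (Matrix I I ℂ)) (T : Submodule ℂ (Matrix J J ℂ)) :
    Submodule ℂ (Matrix (I × J) (I × J) ℂ) :=
  Submodule.span ℂ {Z | ∃ X ∈ S, ∃ Y ∈ T, Z = X ⊗ₖ Y}

theorem kron_mem {I J : Type} {S : Submodule ℂ (Matrix I I ℂ)} {T : Submodule ℂ (Matrix J J ℂ)}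
    {X : Matrix I I ℂ} {Y : Matrix J J ℂ} (hX : X ∈ S) (hY : Y ∈ T) : X ⊗ₖ Y ∈ tensorSpace S T :=
  Submodule.subset_span ⟨X, hX, Y, hY, rfl⟩

theorem tensor_induction {I J : Type} {S : Submodule ℂ (Matrix I I ℂ)}
    {T : Submodule ℂ (Matrix J J ℂ)} {p : Matrix (I × J) (I × J) ℂ → Prop}
    (kron : ∀ X ∈ S, ∀ Y ∈ T, p (X ⊗ₖ Y)) (zero : p 0) (add : ∀ Z W, p Z → p W → p (Z + W))
    (smul : ∀ (c : ℂ) Z, p Z → p (c • Z)) : ∀ Z ∈ tensorSpace S T, p Z := by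
  intro Z hZ
  induction hZ using Submodule.span_induction with
  | mem Z h => obtain ⟨X, hX, Y, hY, rfl⟩ := h; exact kron X hX Y hY
  | zero => exact zero
  | add Z W _ _ h h' => exact add Z W h h'
  | smul c Z _ h => exact smul c Z h

/-- The operator space of a graph, spanned by the matrix units `|g⟩⟨g'|` with `g = g'` or
`{g, g'}` an edge. -/
def graphSpace {V : Type} [DecidableEq V] (G : SimpleGraph V) : Submodule ℂ (Matrix V V ℂ) :=
  Submodule.span ℂ {Z | ∃ g g' : V, (g = g' ∨ G.Adj g g') ∧ Z = Matrix.single g g' 1}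

theorem mem_graphSpace {V : Type} [Fintype V] [DecidableEq V] {G : SimpleGraph V}
    {Z : Matrix V V ℂ} :
    Z ∈ graphSpace G ↔ ∀ g g', ¬ (g = g' ∨ G.Adj g g') → Z g g' = 0 := by
  constructor
  · intro hZ
    induction hZ using Submodule.span_induction with
    | mem Z h =>
      obtain ⟨a, b, hab, rfl⟩ := h
      intro g g' hg
      rw [Matrix.single_apply, if_neg]
      rintro ⟨rfl, rfl⟩
      exact hg hab
    | zero => intros; rfl
    | add Z W _ _ h h' => intro g g' hg; simp [h g g' hg, h' g g' hg]
    | smul c Z _ h => intro g g' hg; simp [h g g' hg]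
  · intro h
    rw [Matrix.matrix_eq_sum_single Z]
    refine Submodule.sum_mem _ fun g _ => Submodule.sum_mem _ fun g' _ => ?_
    by_cases hg : g = g' ∨ G.Adj g g'
    · have : Matrix.single g g' (Z g g') = Z g g' • Matrix.single g g' (1 : ℂ) := by
        rw [Matrix.smul_single]; simp
      rw [this]
      exact Submodule.smul_mem _ _ (Submodule.subset_span ⟨g, g', hg, rfl⟩)
    · rw [h g g' hg, Matrix.single_zero]
      exact Submodule.zero_mem _

/-- The nc-graph `S_G` of a graph `G`. -/
abbrev ofGraph (G : FinGraph) : NCGraph where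
  Idx := G.V
  space := graphSpace G.graph
  conjTranspose_mem X hX := by
    rw [mem_graphSpace] at hX ⊢
    intro g g' hg
    rw [Matrix.conjTranspose_apply, hX g' g (fun h => hg (h.imp Eq.symm fun h => h.symm)),
      star_zero]
  one_mem := by
    rw [mem_graphSpace]
    intro g g' hg
    exact Matrix.one_apply_ne fun h => hg (Or.inl h)

/-- Direct sum of nc-graphs. -/
abbrev directSum (S T : NCGraph) : NCGraph where
  Idx := S.Idx ⊕ T.Idx
  space := sumSpace S.space T.space
  conjTranspose_mem := by
    rintro _ ⟨X, hX, Y, hY, rfl⟩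
    exact ⟨Xᴴ, S.conjTranspose_mem X hX, Yᴴ, T.conjTranspose_mem Y hY, by
      simp [Matrix.fromBlocks_conjTranspose]⟩
  one_mem := ⟨1, S.one_mem, 1, T.one_mem, by simp⟩

/-- Tensor product of nc-graphs. -/
abbrev tensor (S T : NCGraph) : NCGraph where
  Idx := S.Idx × T.Idx
  space := tensorSpace S.space T.space
  conjTranspose_mem := by
    refine tensor_induction ?_ ?_ ?_ ?_
    · intro X hX Y hY
      rw [Matrix.conjTranspose_kronecker]
      exact kron_mem (S.conjTranspose_mem X hX) (T.conjTranspose_mem Y hY)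
    · simp
    · intro Z W hZ hW
      rw [Matrix.conjTranspose_add]
      exact Submodule.add_mem _ hZ hW
    · intro c Z hZ
      rw [Matrix.conjTranspose_smul]
      exact Submodule.smul_mem _ _ hZ
  one_mem := by
    rw [← Matrix.one_kronecker_one]
    exact kron_mem S.one_mem T.one_mem

/-- Isomorphism of nc-graphs: equality up to a unitary transformation. -/
def Isom (S T : NCGraph) : Prop :=
  ∃ U : Matrix S.Idx T.Idx ℂ, U * Uᴴ = 1 ∧ Uᴴ * U = 1 ∧
    (T.space : Set (Matrix T.Idx T.Idx ℂ)) =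
      (fun X : Matrix S.Idx S.Idx ℂ => Uᴴ * X * U) '' S.space

theorem conj_conj {I J : Type} [Fintype I] [Fintype J] [DecidableEq J]
    {U : Matrix I J ℂ} (h : Uᴴ * U = 1) (Y : Matrix J J ℂ) : Uᴴ * (U * Y * Uᴴ) * U = Y := by
  calc Uᴴ * (U * Y * Uᴴ) * U = (Uᴴ * U) * Y * (Uᴴ * U) := by simp only [Matrix.mul_assoc]
    _ = Y := by rw [h, Matrix.one_mul, Matrix.mul_one]

theorem conj_conj' {I J : Type} [Fintype I] [Fintype J] [DecidableEq I]
    {U : Matrix I J ℂ} (h : U * Uᴴ = 1) (X : Matrix I I ℂ) : U * (Uᴴ * X * U) * Uᴴ = X := by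
  calc U * (Uᴴ * X * U) * Uᴴ = (U * Uᴴ) * X * (U * Uᴴ) := by simp only [Matrix.mul_assoc]
    _ = X := by rw [h, Matrix.one_mul, Matrix.mul_one]

theorem isom_iff {S T : NCGraph} : Isom S T ↔ ∃ U : Matrix S.Idx T.Idx ℂ,
    U * Uᴴ = 1 ∧ Uᴴ * U = 1 ∧ (∀ X ∈ S.space, Uᴴ * X * U ∈ T.space) ∧
    ∀ Y ∈ T.space, U * Y * Uᴴ ∈ S.space := by
  constructor
  · rintro ⟨U, h₁, h₂, h⟩
    refine ⟨U, h₁, h₂, fun X hX => ?_, fun Y hY => ?_⟩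
    · rw [← SetLike.mem_coe, h]
      exact ⟨X, hX, rfl⟩
    · rw [← SetLike.mem_coe, h] at hY
      obtain ⟨X, hX, rfl⟩ := hY
      simpa only [conj_conj' h₁, SetLike.mem_coe] using hX
  · rintro ⟨U, h₁, h₂, h, h'⟩
    refine ⟨U, h₁, h₂, Set.Subset.antisymm (fun Y hY => ?_) ?_⟩
    · exact ⟨U * Y * Uᴴ, h' Y hY, conj_conj h₂ Y⟩
    · rintro _ ⟨X, hX, rfl⟩
      exact h X hX

theorem isom_of_equiv {S T : NCGraph} (e : S.Idx ≃ T.Idx)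
    (h : ∀ X ∈ S.space, X.submatrix e.symm e.symm ∈ T.space)
    (h' : ∀ Y ∈ T.space, Y.submatrix e e ∈ S.space) : Isom S T := by
  have key : ∀ Y : Matrix T.Idx T.Idx ℂ, (1 : Matrix T.Idx T.Idx ℂ).submatrix e id * Y *
      ((1 : Matrix T.Idx T.Idx ℂ).submatrix e id)ᴴ = Y.submatrix e e := by
    intro Y
    ext i j
    simp [Matrix.mul_apply, Matrix.one_apply]
  have h₁ : (1 : Matrix T.Idx T.Idx ℂ).submatrix e id *
      ((1 : Matrix T.Idx T.Idx ℂ).submatrix e id)ᴴ = 1 := by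
    have := key 1
    rwa [Matrix.mul_one, Matrix.submatrix_one_equiv] at this
  have h₂ : ((1 : Matrix T.Idx T.Idx ℂ).submatrix e id)ᴴ *
      (1 : Matrix T.Idx T.Idx ℂ).submatrix e id = 1 := by
    ext i j
    simp only [Matrix.mul_apply, Matrix.conjTranspose_apply, Matrix.submatrix_apply]
    rw [id, id, Equiv.sum_comp e (fun k => star ((1 : Matrix T.Idx T.Idx ℂ) k i) *
      (1 : Matrix T.Idx T.Idx ℂ) k j)]
    simp [Matrix.one_apply, eq_comm]
  refine isom_iff.2 ⟨_, h₁, h₂, fun X hX => ?_, fun Y hY => ?_⟩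
  · have := key (X.submatrix e.symm e.symm)
    rw [Matrix.submatrix_submatrix] at this
    simp only [Equiv.symm_comp_self, Matrix.submatrix_id_id] at this
    rw [← this, conj_conj h₂]
    exact h X hX
  · rw [key]
    exact h' Y hY

theorem isom_refl (S : NCGraph) : Isom S S :=
  isom_of_equiv (Equiv.refl _) (fun _ hX => hX) (fun _ hX => hX)

theorem isom_symm {S T : NCGraph} (h : Isom S T) : Isom T S := by
  obtain ⟨U, h₁, h₂, h, h'⟩ := isom_iff.1 h
  exact isom_iff.2 ⟨Uᴴ, by simpa using h₂, by simpa using h₁, by simpa using h', by simpa using h⟩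

theorem isom_trans {S T R : NCGraph} (h : Isom S T) (k : Isom T R) : Isom S R := by
  obtain ⟨U, h₁, h₂, h, h'⟩ := isom_iff.1 h
  obtain ⟨W, k₁, k₂, k, k'⟩ := isom_iff.1 k
  refine isom_iff.2 ⟨U * W, ?_, ?_, fun X hX => ?_, fun Y hY => ?_⟩
  · calc U * W * (U * W)ᴴ = U * (W * Wᴴ) * Uᴴ := by
          simp only [Matrix.conjTranspose_mul, Matrix.mul_assoc]
      _ = 1 := by rw [k₁, Matrix.mul_one, h₁]
  · calc (U * W)ᴴ * (U * W) = Wᴴ * (Uᴴ * U) * W := by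
          simp only [Matrix.conjTranspose_mul, Matrix.mul_assoc]
      _ = 1 := by rw [h₂, Matrix.mul_one, k₂]
  · have := k _ (h X hX)
    simpa only [Matrix.conjTranspose_mul, Matrix.mul_assoc] using this
  · have := h' _ (k' Y hY)
    simpa only [Matrix.conjTranspose_mul, Matrix.mul_assoc] using this

instance setoid : Setoid NCGraph where
  r := Isom
  iseqv := ⟨isom_refl, isom_symm, isom_trans⟩

theorem directSum_congr {S S' T T' : NCGraph} (h₁ : Isom S S') (h₂ : Isom T T') :
    Isom (directSum S T) (directSum S' T') := by
  obtain ⟨U, u₁, u₂, h, h'⟩ := isom_iff.1 h₁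
  obtain ⟨W, w₁, w₂, k, k'⟩ := isom_iff.1 h₂
  refine isom_iff.2 ⟨Matrix.fromBlocks U 0 0 W, ?_, ?_, ?_, ?_⟩
  · simp [Matrix.fromBlocks_conjTranspose, Matrix.fromBlocks_multiply, u₁, w₁, directSum]
  · simp [Matrix.fromBlocks_conjTranspose, Matrix.fromBlocks_multiply, u₂, w₂, directSum]
  · rintro _ ⟨X, hX, Y, hY, rfl⟩
    exact ⟨_, h X hX, _, k Y hY, by
      simp [Matrix.fromBlocks_conjTranspose, Matrix.fromBlocks_multiply, directSum]⟩
  · rintro _ ⟨X, hX, Y, hY, rfl⟩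
    exact ⟨_, h' X hX, _, k' Y hY, by
      simp [Matrix.fromBlocks_conjTranspose, Matrix.fromBlocks_multiply, directSum]⟩

theorem tensor_congr {S S' T T' : NCGraph} (h₁ : Isom S S') (h₂ : Isom T T') :
    Isom (tensor S T) (tensor S' T') := by
  obtain ⟨U, u₁, u₂, h, h'⟩ := isom_iff.1 h₁
  obtain ⟨W, w₁, w₂, k, k'⟩ := isom_iff.1 h₂
  refine isom_iff.2 ⟨U ⊗ₖ W, ?_, ?_, ?_, ?_⟩
  · rw [Matrix.conjTranspose_kronecker]
    exact (Matrix.mul_kronecker_mul _ _ _ _).symm.trans (by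
      rw [u₁, w₁]; exact Matrix.one_kronecker_one)
  · rw [Matrix.conjTranspose_kronecker]
    exact (Matrix.mul_kronecker_mul _ _ _ _).symm.trans (by
      rw [u₂, w₂]; exact Matrix.one_kronecker_one)
  · refine tensor_induction ?_ ?_ ?_ ?_
    · intro X hX Y hY
      have : (U ⊗ₖ W)ᴴ * (X ⊗ₖ Y) * (U ⊗ₖ W) = (Uᴴ * X * U) ⊗ₖ (Wᴴ * Y * W) := by
        rw [Matrix.conjTranspose_kronecker, Matrix.mul_kronecker_mul, Matrix.mul_kronecker_mul]
      exact this ▸ kron_mem (h X hX) (k Y hY)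
    · exact (by simp : (U ⊗ₖ W)ᴴ * (0 : Matrix (S.Idx × T.Idx) (S.Idx × T.Idx) ℂ) * (U ⊗ₖ W) = 0) ▸
        Submodule.zero_mem _
    · intro Z Z' hZ hZ'
      exact (by rw [Matrix.mul_add, Matrix.add_mul] : (U ⊗ₖ W)ᴴ * (Z + Z') * (U ⊗ₖ W) =
        (U ⊗ₖ W)ᴴ * Z * (U ⊗ₖ W) + (U ⊗ₖ W)ᴴ * Z' * (U ⊗ₖ W)) ▸ Submodule.add_mem _ hZ hZ'
    · intro c Z hZ
      exact (by rw [Matrix.mul_smul, Matrix.smul_mul] : (U ⊗ₖ W)ᴴ * (c • Z) * (U ⊗ₖ W) =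
        c • ((U ⊗ₖ W)ᴴ * Z * (U ⊗ₖ W))) ▸ Submodule.smul_mem _ c hZ
  · refine tensor_induction ?_ ?_ ?_ ?_
    · intro X hX Y hY
      have : (U ⊗ₖ W) * (X ⊗ₖ Y) * (U ⊗ₖ W)ᴴ = (U * X * Uᴴ) ⊗ₖ (W * Y * Wᴴ) := by
        rw [Matrix.conjTranspose_kronecker, Matrix.mul_kronecker_mul, Matrix.mul_kronecker_mul]
      exact this ▸ kron_mem (h' X hX) (k' Y hY)
    · exact (by simp : (U ⊗ₖ W) * (0 : Matrix (S'.Idx × T'.Idx) (S'.Idx × T'.Idx) ℂ) * (U ⊗ₖ W)ᴴ = 0) ▸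
        Submodule.zero_mem _
    · intro Z Z' hZ hZ'
      exact (by rw [Matrix.mul_add, Matrix.add_mul] : (U ⊗ₖ W) * (Z + Z') * (U ⊗ₖ W)ᴴ =
        (U ⊗ₖ W) * Z * (U ⊗ₖ W)ᴴ + (U ⊗ₖ W) * Z' * (U ⊗ₖ W)ᴴ) ▸ Submodule.add_mem _ hZ hZ'
    · intro c Z hZ
      exact (by rw [Matrix.mul_smul, Matrix.smul_mul] : (U ⊗ₖ W) * (c • Z) * (U ⊗ₖ W)ᴴ =
        c • ((U ⊗ₖ W) * Z * (U ⊗ₖ W)ᴴ)) ▸ Submodule.smul_mem _ c hZ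

/-- The entanglement-assisted cohomomorphism preorder on nc-graphs: there are a positive definite
density matrix `ρ` on `A₀ = ℂ^d` and Choi-Kraus operators `E i` from `A₁ ⊗ A₀` to `A₂` such that
`E i (X ⊗ ρ) (E j)†` is orthogonal to the second nc-graph for all `i`, `j` and every `X` orthogonal
to the first one. -/
def EALe (S T : NCGraph) : Prop :=
  ∃ (d : ℕ) (ρ : Matrix (Fin d) (Fin d) ℂ) (n : ℕ)
    (E : Fin n → Matrix T.Idx (S.Idx × Fin d) ℂ),
    ρ.PosDef ∧ ρ.trace = 1 ∧ ∑ i, (E i)ᴴ * E i = 1 ∧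
    ∀ i j, ∀ X : Matrix S.Idx S.Idx ℂ, (∀ Y ∈ S.space, HSOrth X Y) →
      ∀ Z ∈ T.space, HSOrth (E i * (X ⊗ₖ ρ) * (E j)ᴴ) Z

theorem hsOrth_conj {I J : Type} [Fintype I] [Fintype J] (U : Matrix I J ℂ) (X : Matrix J J ℂ)
    (Y : Matrix I I ℂ) : HSOrth (U * X * Uᴴ) Y ↔ HSOrth X (Uᴴ * Y * U) := by
  have : ((U * X * Uᴴ)ᴴ * Y).trace = (Xᴴ * (Uᴴ * Y * U)).trace := by
    calc ((U * X * Uᴴ)ᴴ * Y).trace = (U * (Xᴴ * Uᴴ * Y)).trace := by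
          simp only [Matrix.conjTranspose_mul, Matrix.conjTranspose_conjTranspose,
            Matrix.mul_assoc]
      _ = (Xᴴ * (Uᴴ * Y * U)).trace := by
          rw [Matrix.trace_mul_comm]
          simp only [Matrix.mul_assoc]
  unfold HSOrth
  rw [this]

theorem EALe_of_isom {S S' T T' : NCGraph} (h₁ : Isom S S') (h₂ : Isom T T') (hle : EALe S T) :
    EALe S' T' := by
  obtain ⟨U, u₁, u₂, h, h'⟩ := isom_iff.1 h₁
  obtain ⟨W, w₁, w₂, k, k'⟩ := isom_iff.1 h₂
  obtain ⟨d, ρ, n, E, hρ, htr, hE, horth⟩ := hle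
  refine ⟨d, ρ, n, fun i => Wᴴ * E i * (U ⊗ₖ (1 : Matrix (Fin d) (Fin d) ℂ)), hρ, htr, ?_, ?_⟩
  · have : ∀ i, (Wᴴ * E i * (U ⊗ₖ (1 : Matrix (Fin d) (Fin d) ℂ)))ᴴ *
        (Wᴴ * E i * (U ⊗ₖ (1 : Matrix (Fin d) (Fin d) ℂ))) =
        (U ⊗ₖ (1 : Matrix (Fin d) (Fin d) ℂ))ᴴ * ((E i)ᴴ * E i) *
          (U ⊗ₖ (1 : Matrix (Fin d) (Fin d) ℂ)) := by
      intro i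
      calc _ = (U ⊗ₖ (1 : Matrix (Fin d) (Fin d) ℂ))ᴴ * ((E i)ᴴ * ((W * Wᴴ) * E i)) *
          (U ⊗ₖ (1 : Matrix (Fin d) (Fin d) ℂ)) := by
            simp only [Matrix.conjTranspose_mul, Matrix.conjTranspose_conjTranspose,
              Matrix.mul_assoc]
        _ = _ := by rw [w₁, Matrix.one_mul]
    simp only [this]
    rw [← Matrix.sum_mul, ← Matrix.mul_sum, hE, Matrix.mul_one, Matrix.conjTranspose_kronecker,
      ← Matrix.mul_kronecker_mul, u₂]
    simp
  · intro i j X hX Z hZ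
    have e : Wᴴ * E i * (U ⊗ₖ (1 : Matrix (Fin d) (Fin d) ℂ)) * (X ⊗ₖ ρ) *
        (Wᴴ * E j * (U ⊗ₖ (1 : Matrix (Fin d) (Fin d) ℂ)))ᴴ =
        Wᴴ * (E i * ((U * X * Uᴴ) ⊗ₖ ρ) * (E j)ᴴ) * Wᴴᴴ := by
      have : (U * X * Uᴴ) ⊗ₖ ρ = (U ⊗ₖ (1 : Matrix (Fin d) (Fin d) ℂ)) * (X ⊗ₖ ρ) *
          (U ⊗ₖ (1 : Matrix (Fin d) (Fin d) ℂ))ᴴ := by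
        rw [Matrix.conjTranspose_kronecker, ← Matrix.mul_kronecker_mul,
          ← Matrix.mul_kronecker_mul]
        simp
      rw [this]
      simp only [Matrix.conjTranspose_mul, Matrix.mul_assoc]
    beta_reduce
    rw [e, hsOrth_conj]
    apply horth
    · intro Y hY
      rw [hsOrth_conj]
      exact hX _ (h Y hY)
    · simpa using k' Z hZ

theorem tensor_comm (S T : NCGraph) : Isom (tensor S T) (tensor T S) := by
  refine isom_of_equiv (Equiv.prodComm _ _) ?_ ?_
  · refine tensor_induction ?_ (Submodule.zero_mem _) (fun _ _ h h' => Submodule.add_mem _ h h')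
      (fun c _ h => Submodule.smul_mem _ c h)
    intro X hX Y hY
    convert kron_mem hY hX using 1
    ext ⟨a, b⟩ ⟨c, d⟩
    exact mul_comm _ _
  · refine tensor_induction ?_ (Submodule.zero_mem _) (fun _ _ h h' => Submodule.add_mem _ h h')
      (fun c _ h => Submodule.smul_mem _ c h)
    intro X hX Y hY
    convert kron_mem hY hX using 1
    ext ⟨a, b⟩ ⟨c, d⟩
    exact mul_comm _ _

theorem tensor_assoc (S T R : NCGraph) :
    Isom (tensor (tensor S T) R) (tensor S (tensor T R)) := by
  refine isom_of_equiv (Equiv.prodAssoc _ _ _) ?_ ?_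
  · refine tensor_induction ?_ (Submodule.zero_mem _) (fun _ _ h h' => Submodule.add_mem _ h h')
      (fun c _ h => Submodule.smul_mem _ c h)
    intro Z hZ Y hY
    revert Z
    refine tensor_induction ?_ ?_ ?_ ?_
    · intro X hX X' hX'
      convert kron_mem hX (kron_mem hX' hY) using 1
      ext ⟨a, b, c⟩ ⟨a', b', c'⟩
      exact mul_assoc _ _ _
    · rw [Matrix.zero_kronecker]
      exact Submodule.zero_mem _
    · intro Z W h h'
      rw [Matrix.add_kronecker]
      exact Submodule.add_mem _ h h'
    · intro c Z h
      rw [Matrix.smul_kronecker]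
      exact Submodule.smul_mem _ c h
  · refine tensor_induction ?_ (Submodule.zero_mem _) (fun _ _ h h' => Submodule.add_mem _ h h')
      (fun c _ h => Submodule.smul_mem _ c h)
    intro X hX
    refine tensor_induction ?_ ?_ ?_ ?_
    · intro X' hX' Y hY
      convert kron_mem (kron_mem hX hX') hY using 1
      ext ⟨⟨a, b⟩, c⟩ ⟨⟨a', b'⟩, c'⟩
      exact (mul_assoc _ _ _).symm
    · rw [Matrix.kronecker_zero]
      exact Submodule.zero_mem _
    · intro Z W h h'
      rw [Matrix.kronecker_add]
      exact Submodule.add_mem _ h h'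
    · intro c Z h
      rw [Matrix.kronecker_smul]
      exact Submodule.smul_mem _ c h

theorem tensor_add (S T R : NCGraph) :
    Isom (tensor S (directSum T R)) (directSum (tensor S T) (tensor S R)) := by
  refine isom_of_equiv (Equiv.prodSumDistrib _ _ _) ?_ ?_
  · refine tensor_induction ?_ (Submodule.zero_mem _) (fun _ _ h h' => Submodule.add_mem _ h h')
      (fun c _ h => Submodule.smul_mem _ c h)
    rintro X hX _ ⟨Y, hY, Z, hZ, rfl⟩
    refine ⟨_, kron_mem hX hY, _, kron_mem hX hZ, ?_⟩
    ext (⟨a, b⟩ | ⟨a, b⟩) (⟨c, d⟩ | ⟨c, d⟩) <;> simp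
  · rintro _ ⟨Y, hY, Z, hZ, rfl⟩
    have e : (Matrix.fromBlocks Y 0 0 Z).submatrix (Equiv.prodSumDistrib S.Idx T.Idx R.Idx)
        (Equiv.prodSumDistrib S.Idx T.Idx R.Idx) =
        (Matrix.fromBlocks Y 0 0 0).submatrix (Equiv.prodSumDistrib S.Idx T.Idx R.Idx)
        (Equiv.prodSumDistrib S.Idx T.Idx R.Idx) +
        (Matrix.fromBlocks 0 0 0 Z).submatrix (Equiv.prodSumDistrib S.Idx T.Idx R.Idx)
        (Equiv.prodSumDistrib S.Idx T.Idx R.Idx) := by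
      ext ⟨a, b | b⟩ ⟨c, d | d⟩ <;> simp
    refine e ▸ Submodule.add_mem _ ?_ ?_
    · clear e
      revert Y
      refine tensor_induction ?_ ?_ ?_ ?_
      · intro X hX X' hX'
        convert kron_mem hX (mem_sumSpace.2 ⟨X', hX', 0, R.space.zero_mem, rfl⟩) using 1
        ext ⟨a, b | b⟩ ⟨c, d | d⟩ <;> simp
      · convert Submodule.zero_mem _ using 1
        ext ⟨a, b | b⟩ ⟨c, d | d⟩ <;> simp
      · intro A B hA hB
        convert Submodule.add_mem _ hA hB using 1
        ext ⟨a, b | b⟩ ⟨c, d | d⟩ <;> simp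
      · intro c A hA
        convert Submodule.smul_mem _ c hA using 1
        ext ⟨a, b | b⟩ ⟨c, d | d⟩ <;> simp
    · clear e
      revert Z
      refine tensor_induction ?_ ?_ ?_ ?_
      · intro X hX X' hX'
        convert kron_mem hX (mem_sumSpace.2 ⟨0, T.space.zero_mem, X', hX', rfl⟩) using 1
        ext ⟨a, b | b⟩ ⟨c, d | d⟩ <;> simp
      · convert Submodule.zero_mem _ using 1
        ext ⟨a, b | b⟩ ⟨c, d | d⟩ <;> simp
      · intro A B hA hB
        convert Submodule.add_mem _ hA hB using 1
        ext ⟨a, b | b⟩ ⟨c, d | d⟩ <;> simp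
      · intro c A hA
        convert Submodule.smul_mem _ c hA using 1
        ext ⟨a, b | b⟩ ⟨c, d | d⟩ <;> simp

theorem directSum_comm (S T : NCGraph) : Isom (directSum S T) (directSum T S) := by
  refine isom_of_equiv (Equiv.sumComm _ _) ?_ ?_
  · rintro _ ⟨X, hX, Y, hY, rfl⟩
    exact ⟨Y, hY, X, hX, by ext (a | a) (b | b) <;> rfl⟩
  · rintro _ ⟨X, hX, Y, hY, rfl⟩
    exact ⟨Y, hY, X, hX, by ext (a | a) (b | b) <;> rfl⟩

theorem directSum_assoc (S T R : NCGraph) :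
    Isom (directSum (directSum S T) R) (directSum S (directSum T R)) := by
  refine isom_of_equiv (Equiv.sumAssoc _ _ _) ?_ ?_
  · rintro _ ⟨_, ⟨X, hX, Y, hY, rfl⟩, Z, hZ, rfl⟩
    exact ⟨X, hX, _, ⟨Y, hY, Z, hZ, rfl⟩, by ext (a | a | a) (b | b | b) <;> rfl⟩
  · rintro _ ⟨X, hX, _, ⟨Y, hY, Z, hZ, rfl⟩, rfl⟩
    exact ⟨_, ⟨X, hX, Y, hY, rfl⟩, Z, hZ, by ext ((a | a) | a) ((b | b) | b) <;> rfl⟩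

/-- The nc-graph of diagonal `n × n` matrices, i.e. the nc-graph of the edgeless graph. -/
abbrev diag (n : ℕ) : NCGraph := ofGraph (FinGraph.edgeless n)

theorem zero_directSum (S : NCGraph) : Isom (directSum (diag 0) S) S := by
  refine isom_of_equiv (Equiv.emptySum (Fin 0) _) ?_ ?_
  · rintro _ ⟨X, hX, Y, hY, rfl⟩
    exact hY
  · intro Y hY
    refine ⟨0, Submodule.zero_mem _, Y, hY, ?_⟩
    ext (a | a) (b | b)
    · exact Fin.elim0 a
    · exact Fin.elim0 a
    · exact Fin.elim0 b
    · rfl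

theorem zero_tensor (S : NCGraph) : Isom (tensor (diag 0) S) (diag 0) := by
  have i₁ : IsEmpty (tensor (diag 0) S).Idx := ⟨fun p => Fin.elim0 p.1⟩
  have i₂ : IsEmpty (diag 0).Idx := ⟨fun p => Fin.elim0 p⟩
  refine isom_of_equiv (Equiv.equivOfIsEmpty _ _) (fun X _ => ?_) (fun X _ => ?_)
  · convert Submodule.zero_mem _ using 1
    ext a
    exact i₂.elim a
  · convert Submodule.zero_mem _ using 1
    ext a
    exact i₁.elim a

theorem one_tensor (S : NCGraph) : Isom (tensor (diag 1) S) S := by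
  refine isom_of_equiv (Equiv.uniqueProd _ (Fin 1)) ?_ ?_
  · refine tensor_induction ?_ (Submodule.zero_mem _) (fun _ _ h h' => Submodule.add_mem _ h h')
      (fun c _ h => Submodule.smul_mem _ c h)
    intro X _ Y hY
    exact S.space.smul_mem (X (0 : Fin 1) (0 : Fin 1)) hY
  · intro Y hY
    convert kron_mem (diag 1).one_mem hY using 1
    ext ⟨a, b⟩ ⟨c, d⟩
    have : a = c := Subsingleton.elim (α := Fin 1) a c
    subst this
    simp [Matrix.kroneckerMap_apply]

theorem ofGraph_congr {G H : FinGraph} (h : G ≈ H) : Isom (ofGraph G) (ofGraph H) := by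
  obtain ⟨e⟩ := h
  refine isom_of_equiv e.toEquiv ?_ ?_
  · intro X hX
    refine mem_graphSpace.2 fun g g' hg => mem_graphSpace.1 hX _ _ fun hc => hg ?_
    exact hc.imp (fun h => e.symm.injective h) fun h => e.symm.map_rel_iff'.1 h
  · intro X hX
    refine mem_graphSpace.2 fun g g' hg => mem_graphSpace.1 hX _ _ fun hc => hg ?_
    exact hc.imp (fun h => e.injective h) fun h => e.map_rel_iff'.1 h

theorem ofGraph_disjUnion (G H : FinGraph) :
    Isom (ofGraph (G.disjUnion H)) (directSum (ofGraph G) (ofGraph H)) := by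
  refine isom_of_equiv (Equiv.refl _) ?_ ?_
  · intro Z hZ
    have hZ' := mem_graphSpace.1 hZ
    refine ⟨Matrix.toBlocks₁₁ Z, ?_, Matrix.toBlocks₂₂ Z, ?_, ?_⟩
    · refine mem_graphSpace.2 fun g g' hg => hZ' (Sum.inl g) (Sum.inl g') ?_
      simpa [FinGraph.disjUnion] using hg
    · refine mem_graphSpace.2 fun g g' hg => hZ' (Sum.inr g) (Sum.inr g') ?_
      simpa [FinGraph.disjUnion] using hg
    · ext (a | a) (b | b)
      · rfl
      · exact hZ' (Sum.inl a) (Sum.inr b) (by simp [FinGraph.disjUnion])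
      · exact hZ' (Sum.inr a) (Sum.inl b) (by simp [FinGraph.disjUnion])
      · rfl
  · rintro _ ⟨X, hX, Y, hY, rfl⟩
    refine mem_graphSpace.2 ?_
    rintro (a | a) (b | b) hg
    · exact mem_graphSpace.1 hX a b (by simpa [FinGraph.disjUnion] using hg)
    · rfl
    · rfl
    · exact mem_graphSpace.1 hY a b (by simpa [FinGraph.disjUnion] using hg)

theorem ofGraph_strong (G H : FinGraph) :
    Isom (ofGraph (G.strong H)) (tensor (ofGraph G) (ofGraph H)) := by
  refine isom_of_equiv (Equiv.refl _) ?_ ?_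
  · intro Z hZ
    change Z ∈ _
    revert Z
    change graphSpace (FinGraph.strongProd G.graph H.graph) ≤
      tensorSpace (graphSpace G.graph) (graphSpace H.graph)
    refine Submodule.span_le.2 ?_
    rintro _ ⟨⟨a, b⟩, ⟨c, d⟩, hac, rfl⟩
    have : Matrix.single (a, b) (c, d) (1 : ℂ) = Matrix.single a c 1 ⊗ₖ Matrix.single b d 1 := by
      rw [Matrix.single_kronecker_single, mul_one]
    rw [this]
    refine kron_mem (Submodule.subset_span ⟨a, c, ?_, rfl⟩)
      (Submodule.subset_span ⟨b, d, ?_, rfl⟩)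
    · simp only [FinGraph.strongProd, Prod.mk.injEq] at hac
      tauto
    · simp only [FinGraph.strongProd, Prod.mk.injEq] at hac
      tauto
  · refine tensor_induction ?_ (Submodule.zero_mem _) (fun _ _ h h' => Submodule.add_mem _ h h')
      (fun c _ h => Submodule.smul_mem _ c h)
    intro X hX Y hY
    refine mem_graphSpace.2 ?_
    rintro ⟨a, b⟩ ⟨c, d⟩ hg
    change X a c * Y b d = 0
    by_cases h : a = c ∨ G.graph.Adj a c
    · rw [mem_graphSpace.1 hY b d, mul_zero]
      intro h'
      apply hg
      simp only [FinGraph.strong, FinGraph.strongProd, Prod.mk.injEq]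
      tauto
    · rw [mem_graphSpace.1 hX a c h, zero_mul]

end NCGraph

/-- Isomorphism classes of nc-graphs. -/
def NCGraphClass : Type 1 := Quotient NCGraph.setoid

namespace NCGraphClass

open NCGraph

/-- Direct sum of isomorphism classes. -/
def add : NCGraphClass → NCGraphClass → NCGraphClass :=
  Quotient.map₂ directSum fun _ _ h₁ _ _ h₂ => directSum_congr h₁ h₂

/-- Tensor product of isomorphism classes. -/
def mul : NCGraphClass → NCGraphClass → NCGraphClass :=
  Quotient.map₂ tensor fun _ _ h₁ _ _ h₂ => tensor_congr h₁ h₂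

theorem mul_comm' (a b : NCGraphClass) : mul a b = mul b a :=
  Quotient.inductionOn₂ a b fun S T => Quotient.sound (tensor_comm S T)

theorem add_comm' (a b : NCGraphClass) : add a b = add b a :=
  Quotient.inductionOn₂ a b fun S T => Quotient.sound (directSum_comm S T)

theorem zero_add' (a : NCGraphClass) : add (Quotient.mk _ (diag 0)) a = a :=
  Quotient.inductionOn a fun S => Quotient.sound (zero_directSum S)

theorem zero_mul' (a : NCGraphClass) : mul (Quotient.mk _ (diag 0)) a = Quotient.mk _ (diag 0) :=
  Quotient.inductionOn a fun S => Quotient.sound (zero_tensor S)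

theorem one_mul' (a : NCGraphClass) : mul (Quotient.mk _ (diag 1)) a = a :=
  Quotient.inductionOn a fun S => Quotient.sound (one_tensor S)

theorem mul_add' (a b c : NCGraphClass) : mul a (add b c) = add (mul a b) (mul a c) :=
  Quotient.inductionOn₃ a b c fun S T R => Quotient.sound (tensor_add S T R)

/-- The semiring of nc-graphs: direct sum, tensor product, and the nc-graphs of `K_0`, `K_1`. -/
instance commSemiring : CommSemiring NCGraphClass where
  add := add
  mul := mul
  zero := Quotient.mk _ (diag 0)
  one := Quotient.mk _ (diag 1)
  nsmul := @nsmulRec _ ⟨Quotient.mk _ (diag 0)⟩ ⟨add⟩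
  add_assoc a b c := Quotient.inductionOn₃ a b c fun S T R =>
    Quotient.sound (directSum_assoc S T R)
  add_comm := add_comm'
  zero_add := zero_add'
  add_zero a := (add_comm' _ _).trans (zero_add' a)
  mul_assoc a b c := Quotient.inductionOn₃ a b c fun S T R => Quotient.sound (tensor_assoc S T R)
  mul_comm := mul_comm'
  one_mul := one_mul'
  mul_one a := (mul_comm' _ _).trans (one_mul' a)
  zero_mul := zero_mul'
  mul_zero a := (mul_comm' _ _).trans (zero_mul' a)
  left_distrib := mul_add'
  right_distrib a b c := by
    change mul (add a b) c = add (mul a c) (mul b c)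
    rw [mul_comm', mul_add', mul_comm' c a, mul_comm' c b]

/-- The entanglement-assisted cohomomorphism preorder on isomorphism classes of nc-graphs. -/
def EALe : NCGraphClass → NCGraphClass → Prop :=
  Quotient.lift₂ NCGraph.EALe fun _ _ _ _ h₁ h₂ => propext
    ⟨EALe_of_isom h₁ h₂, EALe_of_isom (isom_symm h₁) (isom_symm h₂)⟩

end NCGraphClass

/-- The semiring homomorphism `ι` sending (the class of) a graph `G` to (the class of) `S_G`. -/
def graphToNC : GraphClass →+* NCGraphClass where
  toFun := Quotient.map NCGraph.ofGraph fun _ _ h => NCGraph.ofGraph_congr h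
  map_zero' := rfl
  map_one' := rfl
  map_add' a b := Quotient.inductionOn₂ a b fun G H =>
    Quotient.sound (NCGraph.ofGraph_disjUnion G H)
  map_mul' a b := Quotient.inductionOn₂ a b fun G H =>
    Quotient.sound (NCGraph.ofGraph_strong G H)

/-! ## Strassen preorders and their spectra -/

/-! The relation on graphs is exactly the pullback along `ι` of the relation on nc-graphs
(`graphToNC_EALe_iff`). Hence restriction is well defined, and surjectivity becomes an extension
problem for monotone homomorphisms, solved by Strassen's theory of asymptotic spectra
(`IsStrassen.exists_comp_eq`).

The engine is nonemptiness of the spectrum. By Zorn a Strassen preorder extends to a total one, and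
there each element is located among the fractions, which defines a monotone homomorphism. Applied
after adjoining `b ≤ a`, this gives a duality: if every point of the spectrum is strictly smaller at
`a` than at `b`, then `a ^ k ≤ N * b ^ k` for all `k`, up to asymptotically negligible terms. A
homomorphism `ψ` on the smaller semiring respects such inequalities, so a strict inequality `ψ y < ψ
x` is witnessed weakly by some `φ` of the large spectrum. A sum of squares packs finitely many
approximate equalities into one inequality, so `ψ` is approximated on finite sets by restrictions of
points `φ`, and compactness yields an exact extension.

For nc-graphs the Strassen axioms are checked in the Heisenberg picture, where the dual maps must
send `T` into `S`. An upper bound by a natural number comes from an entangled measurement; the order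
on natural numbers is inherited from the given `ψ`.

For graph spaces, Kraus operators cut into blocks give the matrices `ρ_g^h`. Conversely, square-root
factors of the `ρ_g^h`, renormalised on the support of `ρ`, give Kraus operators. -/

/-- A Strassen preorder on a commutative semiring: a preorder compatible with addition and
multiplication, restricting to the usual order on the natural numbers, and such that every element
lies below a natural number and every nonzero element above `1`. -/
structure IsStrassen {S : Type*} [CommSemiring S] (r : S → S → Prop) : Prop where
  refl : ∀ a, r a a
  trans : ∀ {a b c}, r a b → r b c → r a c
  add_right : ∀ {a b}, r a b → ∀ c, r (a + c) (b + c)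
  mul_right : ∀ {a b}, r a b → ∀ c, r (a * c) (b * c)
  zero_le : ∀ a, r 0 a
  one_le : ∀ {a}, a ≠ 0 → r 1 a
  exists_le_nat : ∀ a, ∃ n : ℕ, r a n
  nat_le : ∀ {n m : ℕ}, r n m → n ≤ m

namespace IsStrassen

section

variable {S : Type*} [CommSemiring S] {r : S → S → Prop}

theorem add_left (h : IsStrassen r) {a b : S} (hab : r a b) (c : S) : r (c + a) (c + b) := by
  rw [add_comm c, add_comm c]; exact h.add_right hab c

theorem mul_left (h : IsStrassen r) {a b : S} (hab : r a b) (c : S) : r (c * a) (c * b) := by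
  rw [mul_comm c, mul_comm c]; exact h.mul_right hab c

theorem add_le_add (h : IsStrassen r) {a b c d : S} (hab : r a b) (hcd : r c d) :
    r (a + c) (b + d) :=
  h.trans (h.add_right hab c) (h.add_left hcd b)

theorem mul_le_mul (h : IsStrassen r) {a b c d : S} (hab : r a b) (hcd : r c d) :
    r (a * c) (b * d) :=
  h.trans (h.mul_right hab c) (h.mul_left hcd b)

theorem le_add_right (h : IsStrassen r) (a b : S) : r a (a + b) := by
  simpa using h.add_left (h.zero_le b) a

theorem le_add_left (h : IsStrassen r) (a b : S) : r a (b + a) := by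
  simpa using h.add_right (h.zero_le b) a

theorem natCast_mono (h : IsStrassen r) {n m : ℕ} (hnm : n ≤ m) : r (n : S) m := by
  obtain ⟨k, rfl⟩ := Nat.exists_eq_add_of_le hnm
  rw [Nat.cast_add]
  exact h.le_add_right _ _

/-! ### Enlarging a Strassen preorder -/

/-- Adding a common summand to a multiple of an inequality that needs it only once. -/
theorem nsmul_add_le (h : IsStrassen r) {x y c : S} (hxy : r (x + c) (y + c)) (k : ℕ) :
    r (k * x + c) (k * y + c) := by
  induction k with
  | zero => simpa using h.refl c
  | succ k ih =>
    have h₁ := h.add_left ih x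
    have h₂ := h.add_left hxy (k * y)
    refine h.trans (b := k * y + (x + c)) ?_ ?_
    · convert h₁ using 1 <;> push_cast <;> ring
    · convert h₂ using 1; push_cast; ring

/-- The common summand is used only once for all `k` copies, so bounding it by `M` leaves an error
independent of `k`, negligible after division by `k`. -/
theorem exists_nsmul_le (h : IsStrassen r) {x y c : S} (hxy : r (x + c) (y + c)) :
    ∃ M : ℕ, ∀ k : ℕ, r (k * x) (k * y + M) := by
  obtain ⟨M, hM⟩ := h.exists_le_nat c
  exact ⟨M, fun k => h.trans (h.le_add_right _ c)
    (h.trans (h.nsmul_add_le hxy k) (h.add_left hM _))⟩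

/-- The cancellative closure of a Strassen preorder. -/
theorem cancel (h : IsStrassen r) : IsStrassen fun x y => ∃ c, r (x + c) (y + c) where
  refl a := ⟨0, h.refl _⟩
  trans := by
    rintro x y z ⟨c, hc⟩ ⟨d, hd⟩
    refine ⟨c + d, h.trans (b := y + (c + d)) ?_ ?_⟩
    · simpa only [add_assoc] using h.add_right hc d
    · convert h.add_right hd c using 1 <;> ring
  add_right := by
    rintro x y ⟨c, hc⟩ z
    refine ⟨c, ?_⟩
    convert h.add_right hc z using 1 <;> ring
  mul_right := by
    rintro x y ⟨c, hc⟩ z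
    exact ⟨c * z, by simpa only [add_mul] using h.mul_right hc z⟩
  zero_le a := ⟨0, by simpa using h.zero_le a⟩
  one_le ha := ⟨0, by simpa using h.one_le ha⟩
  exists_le_nat a := (h.exists_le_nat a).imp fun n hn => ⟨0, by simpa using hn⟩
  nat_le := by
    rintro n m ⟨c, hc⟩
    obtain ⟨M, hM⟩ := h.exists_nsmul_le hc
    by_contra! hlt
    -- Taking `M + 1` copies makes the gain from `m < n` exceed the error `M`.
    have h₁ : (M + 1) * n ≤ (M + 1) * m + M := h.nat_le (by exact_mod_cast hM (M + 1))
    nlinarith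

/-- The extension of a Strassen preorder by the relation `b ≤ a`. -/
theorem extend (h : IsStrassen r) {a b : S}
    (hab : ∀ (n m : ℕ) (s : S), r (n + s * a) (m + s * b) → n ≤ m) :
    IsStrassen fun x y => ∃ s, r (x + s * a) (y + s * b) where
  refl x := ⟨0, by simpa using h.refl x⟩
  trans := by
    rintro x y z ⟨s, hs⟩ ⟨t, ht⟩
    refine ⟨s + t, h.trans (b := y + s * b + t * a) ?_ ?_⟩
    · convert h.add_right hs (t * a) using 1; ring
    · convert h.add_right ht (s * b) using 1 <;> ring
  add_right := by
    rintro x y ⟨s, hs⟩ z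
    refine ⟨s, ?_⟩
    convert h.add_right hs z using 1 <;> ring
  mul_right := by
    rintro x y ⟨s, hs⟩ z
    refine ⟨s * z, ?_⟩
    convert h.mul_right hs z using 1 <;> ring
  zero_le x := ⟨0, by simpa using h.zero_le x⟩
  one_le hx := ⟨0, by simpa using h.one_le hx⟩
  exists_le_nat x := (h.exists_le_nat x).imp fun n hn => ⟨0, by simpa using hn⟩
  nat_le := by
    rintro n m ⟨s, hs⟩
    exact hab n m s hs

/-- The union of a nonempty chain of Strassen preorders is a Strassen preorder. -/
theorem sUnion {C : Set (S → S → Prop)} (hC : IsChain (· ≤ ·) C) (hne : C.Nonempty)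
    (h : ∀ r ∈ C, IsStrassen r) : IsStrassen fun x y => ∃ r ∈ C, r x y := by
  obtain ⟨r₀, hr₀⟩ := hne
  exact
  { refl := fun a => ⟨r₀, hr₀, (h _ hr₀).refl a⟩
    trans := by
      rintro x y z ⟨r, hr, hxy⟩ ⟨r', hr', hyz⟩
      rcases hC.total hr hr' with hle | hle
      · exact ⟨r', hr', (h _ hr').trans (hle _ _ hxy) hyz⟩
      · exact ⟨r, hr, (h _ hr).trans hxy (hle _ _ hyz)⟩
    add_right := fun ⟨r, hr, hxy⟩ c => ⟨r, hr, (h _ hr).add_right hxy c⟩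
    mul_right := fun ⟨r, hr, hxy⟩ c => ⟨r, hr, (h _ hr).mul_right hxy c⟩
    zero_le := fun a => ⟨r₀, hr₀, (h _ hr₀).zero_le a⟩
    one_le := fun ha => ⟨r₀, hr₀, (h _ hr₀).one_le ha⟩
    exists_le_nat := fun a => ((h _ hr₀).exists_le_nat a).imp fun n hn => ⟨r₀, hr₀, hn⟩
    nat_le := fun ⟨_, hr, hnm⟩ => (h _ hr).nat_le hnm }

/-- If the relation `b ≤ a` cannot be adjoined to a cancellative Strassen preorder, then
`1 + s * a ≤ s * b` for some nonzero `s`. -/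
theorem exists_one_add_mul_le (h : IsStrassen r)
    (hc : ∀ {x y c : S}, r (x + c) (y + c) → r x y) {a b : S}
    (hab : ¬ IsStrassen fun x y => ∃ s, r (x + s * a) (y + s * b)) :
    ∃ s, s ≠ 0 ∧ r (1 + s * a) (s * b) := by
  have : ¬ ∀ (n m : ℕ) (s : S), r (n + s * a) (m + s * b) → n ≤ m := fun H => hab (h.extend H)
  push Not at this
  obtain ⟨n, m, s, hs, hlt⟩ := this
  have h₁ : r (1 + s * a) (s * b) := by
    refine hc (c := (m : S)) (h.trans (b := n + s * a) ?_ (by rwa [add_comm (s * b)]))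
    have := h.add_right (h.natCast_mono (S := S) (Nat.succ_le_of_lt hlt)) (s * a)
    convert this using 1
    push_cast; ring
  refine ⟨s, ?_, h₁⟩
  rintro rfl
  have : (1 : ℕ) ≤ 0 := h.nat_le (by simpa using h₁)
  omega

/-! ### Total extensions and their real values -/

/-- Every Strassen preorder extends to a total cancellative one. -/
theorem exists_total (h : IsStrassen r) : ∃ r' : S → S → Prop, r ≤ r' ∧ IsStrassen r' ∧
    ∀ x y, r' x y ∨ r' y x := by
  obtain ⟨r', hle, hmax⟩ := zorn_le_nonempty₀ {r : S → S → Prop | IsStrassen r}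
    (fun C hC hch r₁ hr₁ => ⟨fun x y => ∃ r ∈ C, r x y, sUnion hch ⟨r₁, hr₁⟩ hC,
      fun r hr x y hxy => ⟨r, hr, hxy⟩⟩) r h
  have hr' : IsStrassen r' := hmax.prop
  -- Maximality forces `r'` to equal its own cancellative closure.
  have hc : ∀ {x y c : S}, r' (x + c) (y + c) → r' x y := by
    intro x y c hxy
    exact hmax.le_of_ge (y := fun x y => ∃ c, r' (x + c) (y + c)) hr'.cancel
      (fun x y hxy => ⟨0, by simpa using hxy⟩) _ _ ⟨c, hxy⟩
  -- Adjoining `b ≤ a` would give a strictly larger relation, so by maximality it must break the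
  -- order on the natural numbers.
  have key : ∀ a b, ¬ r' b a → ∃ s, s ≠ 0 ∧ r' (1 + s * a) (s * b) := by
    intro a b hab
    refine hr'.exists_one_add_mul_le hc fun hS => hab ?_
    exact hmax.le_of_ge hS (fun x y hxy => ⟨0, by simpa using hxy⟩) _ _
      ⟨1, by simpa [add_comm] using hr'.refl (a + b)⟩
  refine ⟨r', hle, hr', fun a b => ?_⟩
  by_contra! hab
  obtain ⟨s, hs0, hs⟩ := key b a hab.1
  obtain ⟨t, -, ht⟩ := key a b hab.2
  -- Multiply the inequality for `t` by `s` and the one for `s` by `t`, then chain them. Cancelling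
  -- `s * t * a` leaves `s + t ≤ 0`, impossible since `1 ≤ s`.
  have h₁ : r' (s + t + s * t * a) (0 + s * t * a) := by
    refine hr'.trans (b := t + s * t * b) ?_ ?_
    · convert hr'.add_left (hr'.mul_right ht s) t using 1 <;> ring
    · convert hr'.mul_right hs t using 1 <;> ring
  have h₂ := hr'.trans (hr'.one_le hs0) (hr'.trans (hr'.le_add_right s t) (hc h₁))
  have : (1 : ℕ) ≤ 0 := hr'.nat_le (by simpa using h₂)
  omega

/-- An element of a Strassen preorder that is total lies between consecutive natural numbers. -/
theorem exists_nat_between (h : IsStrassen r) (ht : ∀ x y, r x y ∨ r y x) (a : S) :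
    ∃ p : ℕ, r p a ∧ r a (p + 1 : ℕ) := by
  classical
  have hex := h.exists_le_nat a
  rcases hn : Nat.find hex with _ | p
  · refine ⟨0, by simpa using h.zero_le a, h.trans (Nat.find_spec hex) ?_⟩
    rw [hn]
    exact h.natCast_mono (by omega)
  · refine ⟨p, (ht _ _).resolve_right (Nat.find_min hex (by omega)), ?_⟩
    rw [← hn]
    exact Nat.find_spec hex

/-- A real number whose natural multiples are bounded vanishes. -/
theorem eq_zero_of_forall_nat_mul_le {x C : ℝ} (h : ∀ n : ℕ, n * |x| ≤ C) : x = 0 := by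
  by_contra hx
  obtain ⟨n, hn⟩ := exists_nat_gt (C / |x|)
  have := h n
  rw [div_lt_iff₀ (abs_pos.2 hx)] at hn
  linarith

/-- An element of a Strassen preorder has a real value separating the fractions below it from
those above it. -/
theorem exists_value (h : IsStrassen r) (a : S) :
    ∃ v : ℝ, 0 ≤ v ∧ ∀ n m : ℕ, (r n (m * a) → (n : ℝ) ≤ m * v) ∧
      (r (m * a) n → m * v ≤ n) := by
  have hcmp : ∀ n m n' m' : ℕ, r n (m * a) → r (m' * a) n' → n * m' ≤ n' * m := by
    intro n m n' m' h₁ h₂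
    refine h.nat_le (h.trans (b := m * a * m') ?_ ?_)
    · simpa using h.mul_right h₁ m'
    · convert h.mul_right h₂ m using 1
      · ring
      · simp
  set A : Set ℝ := {x | ∃ n m : ℕ, 0 < m ∧ r n (m * a) ∧ x = n / m} with hA
  have hb : ∀ n' m' : ℕ, 0 < m' → r (m' * a) n' → ∀ x ∈ A, x ≤ n' / m' := by
    rintro n' m' hm' h₂ x ⟨n, m, hm, h₁, rfl⟩
    rw [div_le_div_iff₀ (by positivity) (by positivity)]
    exact_mod_cast hcmp n m n' m' h₁ h₂
  have h0 : (0 : ℝ) ∈ A := ⟨0, 1, one_pos, by simpa using h.zero_le a, by simp⟩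
  obtain ⟨N, hN⟩ := h.exists_le_nat a
  have hbdd : BddAbove A := ⟨_, hb N 1 one_pos (by simpa using hN)⟩
  refine ⟨sSup A, le_csSup hbdd h0, fun n m => ⟨fun h₁ => ?_, fun h₁ => ?_⟩⟩
  · rcases Nat.eq_zero_or_pos m with rfl | hm
    · have : n ≤ 0 := h.nat_le (by simpa using h₁)
      simp [Nat.le_zero.1 this]
    · have := le_csSup hbdd (⟨n, m, hm, h₁, rfl⟩ : (n / m : ℝ) ∈ A)
      rw [div_le_iff₀ (by positivity)] at this
      linarith
  · rcases Nat.eq_zero_or_pos m with rfl | hm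
    · simp
    · have := csSup_le ⟨0, h0⟩ (hb n m hm h₁)
      rw [le_div_iff₀ (by positivity)] at this
      linarith

/-- A total Strassen preorder has a monotone homomorphism to the nonnegative reals. -/
theorem exists_hom_of_total (h : IsStrassen r) (ht : ∀ x y, r x y ∨ r y x) :
    (asymptoticSpectrum S r).Nonempty := by
  choose v hv0 hv using h.exists_value
  have hnat : ∀ n : ℕ, v n = n := by
    intro n
    have h₁ := (hv n n 1).1 (by simpa using h.refl (n : S))
    have h₂ := (hv n n 1).2 (by simpa using h.refl (n : S))
    simp only [Nat.cast_one, one_mul] at h₁ h₂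
    exact le_antisymm h₂ h₁
  have hmono : ∀ a b, r a b → v a ≤ v b := by
    intro a b hab
    by_contra! hlt
    -- Scaling by `q` makes the gap between the values exceed the unit length of the interval that
    -- brackets `q * b`.
    obtain ⟨q, hq⟩ := exists_nat_gt (1 / (v a - v b))
    rw [div_lt_iff₀ (by linarith)] at hq
    obtain ⟨p, hp₁, hp₂⟩ := h.exists_nat_between ht (q * b)
    have h₁ := (hv b p q).1 hp₁
    have h₂ := (hv a (p + 1) q).2 (h.trans (h.mul_left hab q) hp₂)
    push_cast at h₂
    linarith
  have hadd : ∀ a b, v (a + b) = v a + v b := by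
    intro a b
    rw [← sub_eq_zero]
    -- After scaling by `q`, both quantities lie in the interval from `p + p'` to `p + p' + 2`.
    refine eq_zero_of_forall_nat_mul_le (C := 2) fun q => ?_
    obtain ⟨p, hp₁, hp₂⟩ := h.exists_nat_between ht (q * a)
    obtain ⟨p', hp₁', hp₂'⟩ := h.exists_nat_between ht (q * b)
    have h₁ := (hv _ _ _).1 hp₁
    have h₂ := (hv _ _ _).2 hp₂
    have h₁' := (hv _ _ _).1 hp₁'
    have h₂' := (hv _ _ _).2 hp₂'
    have h₃ := (hv (a + b) (p + p') q).1 (by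
      simpa [mul_add] using h.add_le_add hp₁ hp₁')
    have h₄ := (hv (a + b) (p + 1 + (p' + 1)) q).2 (by
      rw [mul_add, Nat.cast_add]; exact h.add_le_add hp₂ hp₂')
    rw [← abs_of_nonneg (Nat.cast_nonneg (α := ℝ) q), ← abs_mul, abs_le]
    push_cast at *
    constructor <;> linarith
  have hmul : ∀ a b, v (a * b) = v a * v b := by
    intro a b
    rw [← sub_eq_zero]
    -- After scaling by `q * q`, both quantities lie between `p * p'` and `(p + 1) * (p' + 1)`. The
    -- width `p + p' + 1` is at most `q * (v a + v b + 1)`, so one factor `q` survives.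
    refine eq_zero_of_forall_nat_mul_le (C := v a + v b + 1) fun q => ?_
    rcases Nat.eq_zero_or_pos q with rfl | hq
    · have := hv0 a; have := hv0 b
      simp only [Nat.cast_zero, zero_mul]; linarith
    obtain ⟨p, hp₁, hp₂⟩ := h.exists_nat_between ht (q * a)
    obtain ⟨p', hp₁', hp₂'⟩ := h.exists_nat_between ht (q * b)
    have h₁ := (hv _ _ _).1 hp₁
    have h₂ := (hv _ _ _).2 hp₂
    have h₁' := (hv _ _ _).1 hp₁'
    have h₂' := (hv _ _ _).2 hp₂'
    have h₃ := (hv (a * b) (p * p') (q * q)).1 (by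
      convert h.mul_le_mul hp₁ hp₁' using 1
      · simp
      · push_cast; ring)
    have h₄ := (hv (a * b) ((p + 1) * (p' + 1)) (q * q)).2 (by
      convert h.mul_le_mul hp₂ hp₂' using 1
      · push_cast; ring
      · simp)
    have hq' : (1 : ℝ) ≤ q := by exact_mod_cast hq
    have h₅ : (p : ℝ) * p' ≤ (q * v a) * (q * v b) :=
      _root_.mul_le_mul h₁ h₁' (by positivity) (by have := hv0 a; positivity)
    have h₆ : (q * v a) * (q * v b) ≤ ((p + 1 : ℕ) : ℝ) * (p' + 1 : ℕ) :=
      _root_.mul_le_mul h₂ h₂' (by have := hv0 b; positivity) (by positivity)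
    push_cast at *
    have key : (q : ℝ) * (q * |v (a * b) - v a * v b|) ≤ q * (v a + v b + 1) := by
      rw [← mul_assoc, ← abs_of_nonneg (by positivity : (0 : ℝ) ≤ q * q), ← abs_mul, abs_le]
      constructor <;> nlinarith
    exact le_of_mul_le_mul_left key (by positivity)
  refine ⟨{ toFun := fun a => ⟨v a, hv0 a⟩, map_one' := ?_, map_zero' := ?_, map_add' := ?_,
            map_mul' := ?_ }, fun a b hab => hmono a b hab⟩
  · exact NNReal.eq ((congrArg v Nat.cast_one.symm).trans ((hnat 1).trans Nat.cast_one))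
  · exact fun a b => NNReal.eq (hmul a b)
  · exact NNReal.eq ((congrArg v Nat.cast_zero.symm).trans ((hnat 0).trans Nat.cast_zero))
  · exact fun a b => NNReal.eq (hadd a b)

/-! ### Nonemptiness of the spectrum and duality -/

theorem spectrum_nonempty (h : IsStrassen r) : (asymptoticSpectrum S r).Nonempty := by
  obtain ⟨r', hle, hr', ht⟩ := h.exists_total
  obtain ⟨φ, hφ⟩ := hr'.exists_hom_of_total ht
  exact ⟨φ, fun a b hab => hφ a b (hle _ _ hab)⟩

/-- If every point of the spectrum is strictly larger on `b` than on `a`, then some power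
inequalities between `a` and `b` hold. -/
theorem exists_pow_le (h : IsStrassen r) {a b : S}
    (hab : ∀ φ ∈ asymptoticSpectrum S r, φ a < φ b) :
    ∃ N : ℕ, ∀ k : ℕ, ∃ M : ℕ, ∀ j : ℕ, r (j * a ^ k) (j * (N * b ^ k) + M) := by
  have hc := h.cancel
  -- A point of the spectrum of the enlarged preorder would satisfy `φ b ≤ φ a`.
  have : ¬ IsStrassen fun x y => ∃ s, ∃ c, r (x + s * a + c) (y + s * b + c) := by
    intro hS
    obtain ⟨φ, hφ⟩ := hS.spectrum_nonempty
    refine (hab φ fun x y hxy => hφ x y ⟨0, 0, by simpa using hxy⟩).not_ge (hφ b a ⟨1, 0, ?_⟩)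
    simpa [add_comm] using h.refl (a + b)
  obtain ⟨s, hs0, hs⟩ := hc.exists_one_add_mul_le (fun {x y c} ⟨d, hd⟩ =>
    ⟨c + d, by simpa only [add_assoc] using hd⟩) this
  obtain ⟨N, hN⟩ := hc.exists_le_nat s
  refine ⟨N, fun k => ?_⟩
  -- The multiplier `s` acts as a catalyst, recovered after each replacement of a factor `a` by `b`.
  -- The final constant `N` therefore does not depend on `k`.
  have hpow : ∃ c, r (s * a ^ k + c) (s * b ^ k + c) := by
    induction k with
    | zero => simpa using hc.refl s
    | succ k ih =>
      refine hc.trans (b := s * b ^ k * a) ?_ ?_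
      · simpa only [pow_succ, mul_assoc] using hc.mul_right ih a
      · convert hc.mul_right (hc.trans (hc.le_add_left (s * a) 1) hs) (b ^ k) using 4 <;> ring
  have h₁ : ∃ c, r (a ^ k + c) (N * b ^ k + c) := by
    refine hc.trans ?_ (hc.trans hpow (hc.mul_right hN _))
    simpa using hc.mul_right (hc.one_le hs0) (a ^ k)
  obtain ⟨c, hc'⟩ := h₁
  exact h.exists_nsmul_le hc'

end

/-! ### Extending a monotone homomorphism along `ι` -/

section Extension

variable {S T : Type*} [CommSemiring S] [CommSemiring T] {r : S → S → Prop}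

/-- Otherwise duality gives power inequalities whose extra coefficients are natural numbers, so both
sides lie in the image of `ι` and `ψ` may be applied. Removing `M` by letting `j` grow, and `N` by
letting `k` grow, contradicts `ψ y < ψ x`. -/
theorem exists_mem_spectrum_le (h : IsStrassen r) (ι : T →+* S) (ψ : T →+* ℝ≥0)
    (hψ : ∀ x y, r (ι x) (ι y) → ψ x ≤ ψ y) {x y : T} (hxy : ψ y < ψ x) :
    ∃ φ ∈ asymptoticSpectrum S r, φ (ι y) ≤ φ (ι x) := by
  by_contra! H
  obtain ⟨N, hN⟩ := h.exists_pow_le H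
  have hpow : ∀ k : ℕ, (ψ x : ℝ) ^ k ≤ N * (ψ y : ℝ) ^ k := by
    intro k
    obtain ⟨M, hM⟩ := hN k
    have hM' : ∀ j : ℕ, (j : ℝ) * (ψ x : ℝ) ^ k ≤ j * (N * (ψ y : ℝ) ^ k) + M := by
      intro j
      have := hψ (j * x ^ k) (j * (N * y ^ k) + M) (by simpa using hM j)
      simp only [map_add, map_mul, map_pow, map_natCast] at this
      exact_mod_cast this
    by_contra! hlt
    obtain ⟨j, hj⟩ := exists_nat_gt (M / ((ψ x : ℝ) ^ k - N * (ψ y : ℝ) ^ k))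
    rw [div_lt_iff₀ (by linarith)] at hj
    have := hM' j
    linarith
  -- When `ψ y = 0` the quotient argument is unavailable, but the first power already suffices.
  rcases eq_or_lt_of_le (ψ y).2 with h0 | hpos
  · have h0' : (ψ y : ℝ) = 0 := h0.symm
    have h₁ := hpow 1
    have h₂ : (ψ y : ℝ) < ψ x := hxy
    simp only [h0', pow_one, mul_zero] at h₁ h₂
    linarith
  · have hpos' : (0 : ℝ) < ψ y := hpos
    have h₂ : (ψ y : ℝ) < ψ x := hxy
    obtain ⟨k, hk⟩ := pow_unbounded_of_one_lt (N : ℝ) ((one_lt_div hpos').2 h₂)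
    rw [div_pow, lt_div_iff₀ (by positivity)] at hk
    exact (hpow k).not_gt hk

/-- Simultaneous closeness on `F` is one inequality: a sum of squares `(D * t - p t) ^ 2` is
bounded, with the negative cross terms moved to the other side so that it makes sense in a semiring.
-/
theorem exists_mem_spectrum_near (h : IsStrassen r) (ι : T →+* S) (ψ : T →+* ℝ≥0)
    (hψ : ∀ x y, r (ι x) (ι y) → ψ x ≤ ψ y) (F : Finset T) (n : ℕ) :
    ∃ φ ∈ asymptoticSpectrum S r, ∀ t ∈ F, (n + 1) * |(φ (ι t) : ℝ) - ψ t| ≤ 1 := by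
  -- The factor `F.card + 2` absorbs the final error: at most `F.card + 1` from the squares and at
  -- most `1` from rounding `D * ψ t` down.
  set D : ℕ := (F.card + 2) * (n + 1) with hD
  set p : T → ℕ := fun t => ⌊(D : ℝ) * ψ t⌋₊ with hp
  have hp₁ : ∀ t, (p t : ℝ) ≤ D * ψ t := fun t => Nat.floor_le (by positivity)
  have hp₂ : ∀ t, (D : ℝ) * ψ t < p t + 1 := fun t => Nat.lt_floor_add_one _
  have hsq : ∀ χ : T →+* ℝ≥0, ((χ (∑ t ∈ F, ((D : T) ^ 2 * t ^ 2 + (p t : T) ^ 2)) : ℝ≥0) : ℝ) -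
      χ (∑ t ∈ F, 2 * (D : T) * p t * t + (F.card + 1 : ℕ)) =
      ∑ t ∈ F, ((D : ℝ) * χ t - p t) ^ 2 - (F.card + 1) := by
    intro χ
    simp only [map_add, map_sum, map_mul, map_pow, map_natCast, map_ofNat]
    push_cast
    rw [← sub_sub, ← Finset.sum_sub_distrib]
    congr 1
    exact Finset.sum_congr rfl fun t _ => by ring
  -- For `ψ` each square is at most `1`; the bound `F.card + 1` instead of `F.card` makes the
  -- inequality strict.
  have hlt : ψ (∑ t ∈ F, ((D : T) ^ 2 * t ^ 2 + (p t : T) ^ 2)) <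
      ψ (∑ t ∈ F, 2 * (D : T) * p t * t + (F.card + 1 : ℕ)) := by
    rw [← NNReal.coe_lt_coe, ← sub_neg, hsq]
    have : ∑ t ∈ F, ((D : ℝ) * ψ t - p t) ^ 2 ≤ ∑ t ∈ F, (1 : ℝ) :=
      Finset.sum_le_sum fun t _ => by nlinarith [hp₁ t, hp₂ t]
    simp only [Finset.sum_const, nsmul_eq_mul, mul_one] at this
    linarith
  obtain ⟨φ, hφ, hle⟩ := h.exists_mem_spectrum_le ι ψ hψ hlt
  refine ⟨φ, hφ, fun t ht => ?_⟩
  have h₁ := hsq (φ.comp ι)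
  simp only [RingHom.comp_apply] at h₁
  have h₂ : ∑ t ∈ F, ((D : ℝ) * φ (ι t) - p t) ^ 2 ≤ F.card + 1 := by
    have := NNReal.coe_le_coe.2 hle
    linarith
  have h₃ : ((D : ℝ) * φ (ι t) - p t) ^ 2 ≤ F.card + 1 :=
    (Finset.single_le_sum (f := fun t => ((D : ℝ) * φ (ι t) - p t) ^ 2)
      (fun t _ => sq_nonneg _) ht).trans h₂
  have h₄ : |(D : ℝ) * φ (ι t) - p t| ≤ F.card + 1 :=
    abs_le_of_sq_le_sq (by nlinarith) (by positivity)
  have h₅ : (F.card + 2 : ℝ) * ((n + 1) * |(φ (ι t) : ℝ) - ψ t|) ≤ (F.card + 2) * 1 := by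
    have : (F.card + 2 : ℝ) * ((n + 1) * |(φ (ι t) : ℝ) - ψ t|) =
        |(D : ℝ) * φ (ι t) - D * ψ t| := by
      rw [← mul_sub, abs_mul, Nat.abs_cast, hD]
      push_cast; ring
    rw [this, abs_le]
    rw [abs_le] at h₄
    constructor <;> linarith [hp₁ t, hp₂ t, h₄.1, h₄.2]
  exact le_of_mul_le_mul_left h₅ (by positivity)

open Filter Topology in
/-- A monotone homomorphism on a semiring mapped into `S` extends to a point of the spectrum of
a Strassen preorder on `S`. -/
theorem exists_comp_eq (h : IsStrassen r) (ι : T →+* S) (ψ : T →+* ℝ≥0)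
    (hψ : ∀ x y, r (ι x) (ι y) → ψ x ≤ ψ y) :
    ∃ φ ∈ asymptoticSpectrum S r, φ.comp ι = ψ := by
  classical
  choose Φ hΦ hnear using h.exists_mem_spectrum_near ι ψ hψ
  -- Along an ultrafilter, every bounded family of values has a limit. The bound on `a` is uniform,
  -- since all approximants are monotone and fix the natural numbers.
  let U : Ultrafilter (Finset T × ℕ) := Ultrafilter.of atTop
  have hU : (U : Filter (Finset T × ℕ)) ≤ atTop := Ultrafilter.of_le atTop
  have hlim : ∀ a, ∃ v : ℝ≥0, Tendsto (fun i : Finset T × ℕ => Φ i.1 i.2 a) U (𝓝 v) := by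
    intro a
    obtain ⟨N, hN⟩ := h.exists_le_nat a
    obtain ⟨v, -, hv⟩ := (isCompact_Icc (a := (0 : ℝ≥0)) (b := N)).ultrafilter_le_nhds
      (U.map fun i : Finset T × ℕ => Φ i.1 i.2 a) (by
        rw [le_principal_iff]
        refine Filter.mem_map.2 (Filter.univ_mem' fun i => ⟨_root_.zero_le, ?_⟩)
        simpa using hΦ i.1 i.2 _ _ hN)
    exact ⟨v, hv⟩
  choose φ hφ using hlim
  refine ⟨{ toFun := φ, map_one' := ?_, map_zero' := ?_, map_add' := ?_, map_mul' := ?_ },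
    fun a b hab => ?_, ?_⟩
  · exact tendsto_nhds_unique (hφ 1) (by simp)
  · exact fun a b => tendsto_nhds_unique (hφ (a * b)) (by simpa using (hφ a).mul (hφ b))
  · exact tendsto_nhds_unique (hφ 0) (by simp)
  · exact fun a b => tendsto_nhds_unique (hφ (a + b)) (by simpa using (hφ a).add (hφ b))
  · exact le_of_tendsto_of_tendsto (hφ a) (hφ b) (Eventually.of_forall fun i => hΦ i.1 i.2 a b hab)
  · ext t
    have h₁ : Tendsto (fun i : Finset T × ℕ => (Φ i.1 i.2 (ι t) : ℝ)) U (𝓝 (φ (ι t))) :=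
      (NNReal.continuous_coe.tendsto _).comp (hφ (ι t))
    refine tendsto_nhds_unique h₁ (Tendsto.mono_left ?_ hU)
    rw [tendsto_iff_dist_tendsto_zero]
    have h₂ : Tendsto (fun i : Finset T × ℕ => 1 / ((i.2 : ℝ) + 1)) atTop (𝓝 0) := by
      rw [← prod_atTop_atTop_eq]
      exact tendsto_one_div_add_atTop_nhds_zero_nat.comp tendsto_snd
    refine squeeze_zero' (Eventually.of_forall fun _ => dist_nonneg) ?_ h₂
    filter_upwards [eventually_ge_atTop ((({t} : Finset T), 0) : Finset T × ℕ)] with i hi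
    have := hnear i.1 i.2 t (Finset.singleton_subset_iff.1 hi.1)
    rw [le_div_iff₀ (by positivity), Real.dist_eq]
    linarith

end Extension

end IsStrassen

/-! ## The entanglement-assisted preorder on nc-graphs is a Strassen preorder -/

namespace NCGraph

/-! ### Partial traces and the dual form of the preorder -/

section PartialTrace

variable {I J κ κ' : Type} [Fintype κ] [Fintype κ']

/-- The partial trace of `(1 ⊗ ρ) * M` over the second factor. -/
def weightedPartialTrace (ρ : Matrix κ κ ℂ) (M : Matrix (I × κ) (I × κ) ℂ) : Matrix I I ℂ :=
  Matrix.of fun a b => ∑ k, ∑ l, ρ l k * M (a, k) (b, l)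

theorem weightedPartialTrace_apply (ρ : Matrix κ κ ℂ) (M : Matrix (I × κ) (I × κ) ℂ) (a b : I) :
    weightedPartialTrace ρ M a b = ∑ k, ∑ l, ρ l k * M (a, k) (b, l) := rfl

/-- This makes the weighted partial trace the transpose of `X ↦ X ⊗ₖ ρ` for the bilinear trace
pairing. -/
theorem trace_kronecker_mul [Fintype I] (X : Matrix I I ℂ) (ρ : Matrix κ κ ℂ)
    (M : Matrix (I × κ) (I × κ) ℂ) :
    ((X ⊗ₖ ρ) * M).trace = (X * weightedPartialTrace ρ M).trace := by
  simp only [Matrix.trace, Matrix.diag_apply, Matrix.mul_apply, Matrix.kroneckerMap_apply,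
    weightedPartialTrace_apply, Fintype.sum_prod_type, Finset.mul_sum]
  refine Finset.sum_congr rfl fun a _ => ?_
  rw [Finset.sum_comm]
  refine Finset.sum_congr rfl fun b _ => ?_
  rw [Finset.sum_comm]
  refine Finset.sum_congr rfl fun k _ => Finset.sum_congr rfl fun l _ => ?_
  ring

/-- For composing protocols: the inner map consumes `ρ'`, the outer one consumes `ρ`, and a product
ancilla performs both traces. -/
theorem weightedPartialTrace_kronecker [Fintype J] [DecidableEq κ'] (ρ : Matrix κ κ ℂ)
    (ρ' : Matrix κ' κ' ℂ) (E F : Matrix J (I × κ) ℂ) (N : Matrix (J × κ') (J × κ') ℂ) :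
    weightedPartialTrace (ρ ⊗ₖ ρ')
      (((E ⊗ₖ (1 : Matrix κ' κ' ℂ)).submatrix id (Equiv.prodAssoc I κ κ').symm)ᴴ * N *
        (F ⊗ₖ (1 : Matrix κ' κ' ℂ)).submatrix id (Equiv.prodAssoc I κ κ').symm) =
    weightedPartialTrace ρ (Eᴴ * weightedPartialTrace ρ' N * F) := by
  ext a b
  have hK : ∀ k l k₂ l₂, (((E ⊗ₖ (1 : Matrix κ' κ' ℂ)).submatrix id
      (Equiv.prodAssoc I κ κ').symm)ᴴ * N *
      (F ⊗ₖ (1 : Matrix κ' κ' ℂ)).submatrix id (Equiv.prodAssoc I κ κ').symm)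
      (a, k, l) (b, k₂, l₂) =
      ∑ t₂, ∑ t, star (E t (a, k)) * N (t, l) (t₂, l₂) * F t₂ (b, k₂) := by
    intro k l k₂ l₂
    simp [Matrix.mul_apply, Fintype.sum_prod_type, Matrix.one_apply, Finset.sum_mul, apply_ite]
  simp only [weightedPartialTrace_apply, Fintype.sum_prod_type, hK, Matrix.mul_apply,
    Matrix.conjTranspose_apply, Matrix.kroneckerMap_apply]
  refine Finset.sum_congr rfl fun k _ => ?_
  rw [Finset.sum_comm]
  refine Finset.sum_congr rfl fun k₂ _ => ?_
  simp only [Finset.mul_sum, Finset.sum_mul]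
  simp only [← Fintype.sum_prod_type']
  refine Fintype.sum_equiv ⟨fun p => (p.2.2.1, p.2.2.2, p.1, p.2.1),
    fun p => (p.2.2.1, p.2.2.2, p.1, p.2.1), fun _ => rfl, fun _ => rfl⟩ _ _ fun p => ?_
  simp only [Equiv.coe_fn_mk]
  ring

theorem hsOrth_kraus_iff [Fintype I] [Fintype J] {ρ : Matrix κ κ ℂ} (hρ : ρᴴ = ρ)
    (E F : Matrix J (I × κ) ℂ) (X : Matrix I I ℂ) (Z : Matrix J J ℂ) :
    HSOrth (E * (X ⊗ₖ ρ) * Fᴴ) Z ↔ HSOrth X (weightedPartialTrace ρ (Eᴴ * Z * F)) := by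
  unfold HSOrth
  rw [← trace_kronecker_mul]
  simp only [Matrix.conjTranspose_mul, Matrix.conjTranspose_conjTranspose,
    Matrix.conjTranspose_kronecker, hρ]
  rw [Matrix.mul_assoc, Matrix.trace_mul_comm]
  simp only [Matrix.mul_assoc]

end PartialTrace

/-- A space of matrices is its own double orthogonal complement. -/
theorem mem_of_forall_hsOrth {I : Type} [Fintype I] [DecidableEq I]
    (S : Submodule ℂ (Matrix I I ℂ)) {M : Matrix I I ℂ}
    (h : ∀ X : Matrix I I ℂ, (∀ Y ∈ S, HSOrth X Y) → HSOrth X M) : M ∈ S := by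
  by_contra hM
  obtain ⟨f, hf, hS⟩ := Submodule.exists_dual_map_eq_bot_of_notMem hM inferInstance
  have key : ∀ B : Matrix I I ℂ,
      ((Matrix.of fun i j => star (f (Matrix.single i j 1)))ᴴ * B).trace = f B := by
    intro B
    conv_rhs => rw [Matrix.matrix_eq_sum_single B]
    simp only [Matrix.trace, Matrix.diag_apply, Matrix.mul_apply, Matrix.conjTranspose_apply,
      Matrix.of_apply, star_star, map_sum]
    rw [Finset.sum_comm]
    refine Finset.sum_congr rfl fun i _ => Finset.sum_congr rfl fun j _ => ?_
    have : Matrix.single i j (B i j) = B i j • Matrix.single i j (1 : ℂ) := by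
      rw [Matrix.smul_single]; simp
    rw [this, map_smul, smul_eq_mul, mul_comm]
  refine hf ?_
  rw [← key]
  refine h _ fun Y hY => ?_
  unfold HSOrth
  rw [key]
  have : f Y ∈ S.map f := Submodule.mem_map_of_mem hY
  rwa [hS, Submodule.mem_bot] at this

/-- A description of the preorder by partial traces, with arbitrary index types for the ancilla
and the Kraus operators. -/
theorem EALe_intro {S T : NCGraph} {κ ι : Type} [Fintype κ] [DecidableEq κ] [Fintype ι]
    (ρ : Matrix κ κ ℂ) (E : ι → Matrix T.Idx (S.Idx × κ) ℂ) (hρ : ρ.PosDef) (htr : ρ.trace = 1)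
    (hE : ∑ i, (E i)ᴴ * E i = 1)
    (h : ∀ i j, ∀ Z ∈ T.space, weightedPartialTrace ρ ((E i)ᴴ * Z * E j) ∈ S.space) :
    EALe S T := by
  let e := Fintype.equivFin κ
  let f := Fintype.equivFin ι
  let g : S.Idx × Fin (Fintype.card κ) ≃ S.Idx × κ := (Equiv.refl _).prodCongr e.symm
  refine ⟨_, ρ.submatrix e.symm e.symm, _, fun i => (E (f.symm i)).submatrix id g,
    hρ.submatrix e.symm.injective, ?_, ?_, ?_⟩
  · rw [← htr]
    exact Equiv.sum_comp e.symm fun k => ρ k k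
  · have : ∀ i, ((E i).submatrix id g)ᴴ * (E i).submatrix id g =
        ((E i)ᴴ * E i).submatrix g g := by
      intro i
      rw [Matrix.conjTranspose_submatrix, ← Matrix.submatrix_mul _ _ _ id _ Function.bijective_id]
    simp only [this]
    rw [Equiv.sum_comp f.symm fun i => ((E i)ᴴ * E i).submatrix g g]
    have h1 : ∑ i, ((E i)ᴴ * E i).submatrix g g = (∑ i, (E i)ᴴ * E i).submatrix g g := by
      ext a b
      simp [Matrix.sum_apply]
    rw [h1, hE, Matrix.submatrix_one_equiv]
  · intro i j X hX Z hZ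
    have h1 : (E (f.symm i)).submatrix id g * (X ⊗ₖ ρ.submatrix e.symm e.symm) *
        ((E (f.symm j)).submatrix id g)ᴴ = E (f.symm i) * (X ⊗ₖ ρ) * (E (f.symm j))ᴴ := by
      have : X ⊗ₖ ρ.submatrix e.symm e.symm = (X ⊗ₖ ρ).submatrix g g := rfl
      rw [this, Matrix.conjTranspose_submatrix,
        ← Matrix.submatrix_mul _ _ _ g _ g.bijective, ← Matrix.submatrix_mul _ _ _ g _ g.bijective,
        Matrix.submatrix_id_id]
    beta_reduce
    rw [h1, hsOrth_kraus_iff hρ.isHermitian]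
    exact hX _ (h _ _ Z hZ)

/-- Moving the Kraus map to the other side of the pairing puts each partial trace in the double
orthogonal complement of `S.space`, which is `S.space` itself by finite dimensionality. -/
theorem EALe_elim {S T : NCGraph} (hle : EALe S T) :
    ∃ (d : ℕ) (ρ : Matrix (Fin d) (Fin d) ℂ) (n : ℕ)
      (E : Fin n → Matrix T.Idx (S.Idx × Fin d) ℂ),
      ρ.PosDef ∧ ρ.trace = 1 ∧ ∑ i, (E i)ᴴ * E i = 1 ∧
      ∀ i j, ∀ Z ∈ T.space, weightedPartialTrace ρ ((E i)ᴴ * Z * E j) ∈ S.space := by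
  obtain ⟨d, ρ, n, E, hρ, htr, hE, h⟩ := hle
  refine ⟨d, ρ, n, E, hρ, htr, hE, fun i j Z hZ => mem_of_forall_hsOrth _ fun X hX => ?_⟩
  rw [← hsOrth_kraus_iff hρ.isHermitian]
  exact h i j X hX Z hZ

/-! ### Compatibility with composition and the semiring operations -/

theorem EALe_refl (S : NCGraph) : EALe S S := by
  refine EALe_intro (κ := Unit) (ι := Unit) 1
    (fun _ => (1 : Matrix S.Idx S.Idx ℂ).submatrix id (Equiv.prodPUnit _)) Matrix.PosDef.one
    (by simp) ?_ ?_
  · rw [Finset.univ_unique, Finset.sum_singleton, Matrix.conjTranspose_submatrix,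
      ← Matrix.submatrix_mul _ _ _ id _ Function.bijective_id]
    simp
  · intro _ _ Z hZ
    convert hZ using 1
    rw [← Matrix.submatrix_id_id Z, Matrix.conjTranspose_submatrix,
      ← Matrix.submatrix_mul _ _ _ id _ Function.bijective_id,
      ← Matrix.submatrix_mul _ _ _ id _ Function.bijective_id]
    ext a b
    simp [weightedPartialTrace_apply]

theorem EALe_trans {S T R : NCGraph} (h₁ : EALe S T) (h₂ : EALe T R) : EALe S R := by
  obtain ⟨d, ρ, n, E, hρ, htr, hE, h⟩ := EALe_elim h₁
  obtain ⟨d', ρ', n', E', hρ', htr', hE', h'⟩ := EALe_elim h₂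
  let g : S.Idx × Fin d × Fin d' ≃ (S.Idx × Fin d) × Fin d' := (Equiv.prodAssoc _ _ _).symm
  -- The first protocol runs while the ancilla of the second is kept untouched.
  let K : Fin n → Matrix (T.Idx × Fin d') (S.Idx × Fin d × Fin d') ℂ := fun i =>
    (E i ⊗ₖ (1 : Matrix (Fin d') (Fin d') ℂ)).submatrix id g
  have hK : ∑ i, (K i)ᴴ * K i = 1 := by
    have : ∀ i, (K i)ᴴ * K i =
        (((E i)ᴴ * E i) ⊗ₖ (1 : Matrix (Fin d') (Fin d') ℂ)).submatrix g g := by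
      intro i
      rw [Matrix.conjTranspose_submatrix, ← Matrix.submatrix_mul _ _ _ id _ Function.bijective_id,
        Matrix.conjTranspose_kronecker, ← Matrix.mul_kronecker_mul]
      simp
    rw [← Matrix.submatrix_one_equiv g, ← Matrix.one_kronecker_one, ← hE]
    ext a b
    simp only [this, Matrix.sum_apply, Matrix.submatrix_apply, Matrix.kroneckerMap_apply,
      Finset.sum_mul]
  refine EALe_intro (ι := Fin n' × Fin n) (ρ ⊗ₖ ρ') (fun i => E' i.1 * K i.2) (hρ.kronecker hρ')
    ?_ ?_ ?_
  · rw [Matrix.trace_kronecker, htr, htr', one_mul]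
  · rw [Fintype.sum_prod_type, Finset.sum_comm]
    have : ∀ i j, (E' j * K i)ᴴ * (E' j * K i) = (K i)ᴴ * ((E' j)ᴴ * E' j) * K i := by
      intro i j
      simp only [Matrix.conjTranspose_mul, Matrix.mul_assoc]
    simp only [this, ← Matrix.sum_mul, ← Matrix.mul_sum, hE', Matrix.mul_one, hK]
  · rintro ⟨j, i⟩ ⟨j', i'⟩ Z hZ
    convert h i i' _ (h' j j' Z hZ) using 1
    have : (E' j * K i)ᴴ * Z * (E' j' * K i') = (K i)ᴴ * ((E' j)ᴴ * Z * E' j') * K i' := by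
      simp only [Matrix.conjTranspose_mul, Matrix.mul_assoc]
    rw [this]
    exact weightedPartialTrace_kronecker ρ ρ' (E i) (E i') _

theorem EALe_tensor {S S' : NCGraph} (hle : EALe S S') (T : NCGraph) :
    EALe (tensor S T) (tensor S' T) := by
  obtain ⟨d, ρ, n, E, hρ, htr, hE, h⟩ := EALe_elim hle
  let g : (S.Idx × T.Idx) × Fin d ≃ (S.Idx × Fin d) × T.Idx :=
    ⟨fun p => ((p.1.1, p.2), p.1.2), fun p => ((p.1.1, p.2), p.1.2), fun _ => rfl, fun _ => rfl⟩
  have hF : ∀ i j (X : Matrix S'.Idx S'.Idx ℂ) (Y : Matrix T.Idx T.Idx ℂ),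
      ((E i ⊗ₖ (1 : Matrix T.Idx T.Idx ℂ)).submatrix id g)ᴴ * (X ⊗ₖ Y) *
        (E j ⊗ₖ (1 : Matrix T.Idx T.Idx ℂ)).submatrix id g =
      (((E i)ᴴ * X * E j) ⊗ₖ Y).submatrix g g := by
    intro i j X Y
    rw [Matrix.conjTranspose_submatrix, ← Matrix.submatrix_id_id (X ⊗ₖ Y),
      ← Matrix.submatrix_mul _ _ _ id _ Function.bijective_id,
      ← Matrix.submatrix_mul _ _ _ id _ Function.bijective_id,
      Matrix.conjTranspose_kronecker, ← Matrix.mul_kronecker_mul, ← Matrix.mul_kronecker_mul]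
    simp
  refine EALe_intro ρ (fun i => (E i ⊗ₖ (1 : Matrix T.Idx T.Idx ℂ)).submatrix id g) hρ htr ?_ ?_
  · have : ∀ i, ((E i ⊗ₖ (1 : Matrix T.Idx T.Idx ℂ)).submatrix id g)ᴴ *
        (E i ⊗ₖ (1 : Matrix T.Idx T.Idx ℂ)).submatrix id g =
        (((E i)ᴴ * E i) ⊗ₖ (1 : Matrix T.Idx T.Idx ℂ)).submatrix g g := by
      intro i
      simpa using hF i i 1 1
    rw [← Matrix.submatrix_one_equiv g, ← Matrix.one_kronecker_one, ← hE]
    ext a b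
    simp only [this, Matrix.sum_apply, Matrix.submatrix_apply, Matrix.kroneckerMap_apply,
      Finset.sum_mul]
  · intro i j
    have hadd : ∀ M N : Matrix ((S.Idx × T.Idx) × Fin d) ((S.Idx × T.Idx) × Fin d) ℂ,
      weightedPartialTrace ρ (M + N) = weightedPartialTrace ρ M + weightedPartialTrace ρ N := by
      intro M N
      ext a b
      simp [weightedPartialTrace_apply, mul_add, Finset.sum_add_distrib]
    have hsmul : ∀ (c : ℂ) (M : Matrix ((S.Idx × T.Idx) × Fin d) ((S.Idx × T.Idx) × Fin d) ℂ),
      weightedPartialTrace ρ (c • M) = c • weightedPartialTrace ρ M := by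
      intro c M
      ext a b
      simp [weightedPartialTrace_apply, Finset.mul_sum, mul_left_comm]
    refine tensor_induction ?_ ?_ ?_ ?_
    · intro X hX Y hY
      convert kron_mem (h i j X hX) hY using 1
      rw [hF]
      ext ⟨a, c⟩ ⟨b, c'⟩
      change ∑ k, ∑ l, ρ l k * (((E i)ᴴ * X * E j) (a, k) (b, l) * Y c c') =
        (∑ k, ∑ l, ρ l k * ((E i)ᴴ * X * E j) (a, k) (b, l)) * Y c c'
      simp only [Finset.sum_mul, mul_assoc]
    · convert Submodule.zero_mem _ using 1
      rw [Matrix.mul_zero, Matrix.zero_mul]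
      ext a b
      simp [weightedPartialTrace_apply]
    · intro Z W hZ hW
      rw [Matrix.mul_add, Matrix.add_mul, hadd]
      exact Submodule.add_mem _ hZ hW
    · intro c Z hZ
      rw [Matrix.mul_smul, Matrix.smul_mul, hsmul]
      exact Submodule.smul_mem _ c hZ

/-- Run the given protocol on the first block and discard the ancilla on the second. Cross terms
vanish because the target operators are block diagonal. -/
theorem EALe_directSum {S S' : NCGraph} (hle : EALe S S') (T : NCGraph) :
    EALe (directSum S T) (directSum S' T) := by
  obtain ⟨d, ρ, n, E, hρ, htr, hE, h⟩ := EALe_elim hle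
  let g : (S.Idx ⊕ T.Idx) × Fin d ≃ (S.Idx × Fin d) ⊕ (T.Idx × Fin d) :=
    Equiv.sumProdDistrib _ _ _
  -- These are `1 ⊗ ⟨k|`, the Kraus operators that trace out the ancilla.
  let C : Fin d → Matrix T.Idx (T.Idx × Fin d) ℂ := fun k =>
    Matrix.of fun t p => if t = p.1 ∧ k = p.2 then 1 else 0
  have hC : ∀ k l (Y : Matrix T.Idx T.Idx ℂ), (C k)ᴴ * Y * C l =
      Matrix.of fun p q => if k = p.2 ∧ l = q.2 then Y p.1 q.1 else 0 := by
    intro k l Y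
    ext ⟨t, k'⟩ ⟨t', l'⟩
    by_cases hk : k = k' <;> by_cases hl : l = l' <;>
      simp [C, Matrix.mul_apply, hk, hl, apply_ite]
  let F : Fin n ⊕ Fin d → Matrix (S'.Idx ⊕ T.Idx) ((S.Idx ⊕ T.Idx) × Fin d) ℂ := Sum.elim
    (fun i => (Matrix.fromBlocks (E i) 0 0 0).submatrix id g)
    (fun k => (Matrix.fromBlocks 0 0 0 (C k)).submatrix id g)
  refine EALe_intro ρ F hρ htr ?_ ?_
  · rw [Fintype.sum_sum_type]
    have h₁ : ∀ i, (F (Sum.inl i))ᴴ * F (Sum.inl i) =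
        (Matrix.fromBlocks ((E i)ᴴ * E i) 0 0 0).submatrix g g := by
      intro i
      simp only [F, Sum.elim_inl]
      rw [Matrix.conjTranspose_submatrix, ← Matrix.submatrix_mul _ _ _ id _ Function.bijective_id]
      simp [Matrix.fromBlocks_conjTranspose, Matrix.fromBlocks_multiply]
    have h₂ : ∀ k, (F (Sum.inr k))ᴴ * F (Sum.inr k) =
        (Matrix.fromBlocks 0 0 0 ((C k)ᴴ * (1 : Matrix T.Idx T.Idx ℂ) * C k)).submatrix g g := by
      intro i
      simp only [F, Sum.elim_inr]
      rw [Matrix.conjTranspose_submatrix, ← Matrix.submatrix_mul _ _ _ id _ Function.bijective_id]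
      simp [Matrix.fromBlocks_conjTranspose, Matrix.fromBlocks_multiply]
    simp only [h₁, h₂, hC]
    rw [← Matrix.submatrix_one_equiv g, ← Matrix.fromBlocks_one, ← hE]
    ext a b
    simp only [Matrix.add_apply, Matrix.sum_apply, Matrix.submatrix_apply]
    rcases g a with p | ⟨t, k⟩ <;> rcases g b with q | ⟨t', k'⟩
    · simp [Matrix.sum_apply]
    · simp
    · simp
    · by_cases hk : k = k'
      · subst hk; simp [Matrix.one_apply]
      · have : ∀ x, ¬ (x = k ∧ x = k') := fun x hx => hk (hx.1.symm.trans hx.2)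
        simp [Matrix.one_apply, hk, this]
  · have hsub : ∀ (A B : Matrix (S'.Idx ⊕ T.Idx) ((S.Idx × Fin d) ⊕ (T.Idx × Fin d)) ℂ)
        (Z : Matrix (S'.Idx ⊕ T.Idx) (S'.Idx ⊕ T.Idx) ℂ),
        (A.submatrix id g)ᴴ * Z * B.submatrix id g = (Aᴴ * Z * B).submatrix g g := by
      intro A B Z
      rw [Matrix.conjTranspose_submatrix, ← Matrix.submatrix_id_id Z,
        ← Matrix.submatrix_mul _ _ _ id _ Function.bijective_id,
        ← Matrix.submatrix_mul _ _ _ id _ Function.bijective_id]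
      simp
    have hblock : ∀ (A : Matrix (S.Idx × Fin d) (S.Idx × Fin d) ℂ)
        (D : Matrix (T.Idx × Fin d) (T.Idx × Fin d) ℂ),
        weightedPartialTrace ρ ((Matrix.fromBlocks A 0 0 D).submatrix g g) =
        Matrix.fromBlocks (weightedPartialTrace ρ A) 0 0 (weightedPartialTrace ρ D) := by
      intro A D
      ext (a | a) (b | b) <;> simp [weightedPartialTrace_apply, g]
    have hz : weightedPartialTrace ρ (0 : Matrix (T.Idx × Fin d) (T.Idx × Fin d) ℂ) = 0 := by
      ext; simp [weightedPartialTrace_apply]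
    have hz' : weightedPartialTrace ρ (0 : Matrix (S.Idx × Fin d) (S.Idx × Fin d) ℂ) = 0 := by
      ext; simp [weightedPartialTrace_apply]
    rintro i j _ ⟨X, hX, Y, hY, rfl⟩
    rcases i with i | k <;> rcases j with j | l <;>
      simp only [F, Sum.elim_inl, Sum.elim_inr, hsub, Matrix.fromBlocks_conjTranspose,
        Matrix.fromBlocks_multiply, Matrix.mul_zero, Matrix.zero_mul, add_zero, zero_add,
        Matrix.conjTranspose_zero, hblock]
    · exact ⟨_, h i j X hX, 0, T.space.zero_mem, by rw [hz]⟩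
    · exact ⟨0, S.space.zero_mem, 0, T.space.zero_mem, by rw [hz, hz']⟩
    · exact ⟨0, S.space.zero_mem, 0, T.space.zero_mem, by rw [hz, hz']⟩
    · refine ⟨0, S.space.zero_mem, ρ l k • Y, T.space.smul_mem _ hY, ?_⟩
      rw [hz', hC]
      congr 1
      ext t t'
      simp [weightedPartialTrace_apply, ite_and]

/-! ### Comparison with zero, one and the natural numbers -/

theorem zero_EALe (S : NCGraph) : EALe (diag 0) S := by
  have : IsEmpty (diag 0).Idx := ⟨fun p => Fin.elim0 p⟩
  -- On the zero space an empty family of Kraus operators already sums to the identity.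
  refine EALe_intro (κ := Unit) (ι := Empty) 1 Empty.elim Matrix.PosDef.one (by simp) ?_ ?_
  · ext a; exact this.elim a.1
  · intro i; exact i.elim

theorem one_EALe (S : NCGraph) [Nonempty S.Idx] : EALe (diag 1) S := by
  obtain ⟨v⟩ := ‹Nonempty S.Idx›
  refine EALe_intro (κ := Unit) (ι := Unit) 1 (fun _ => Matrix.of fun a _ => if a = v then 1 else 0)
    Matrix.PosDef.one (by simp) ?_ ?_
  · ext ⟨a, _⟩ ⟨b, _⟩
    have : a = b := Subsingleton.elim (α := Fin 1) a b
    subst this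
    simp [Matrix.mul_apply, apply_ite]
  · intro i j Z _
    rw [mem_graphSpace]
    intro a b hab
    exact absurd (Or.inl (Subsingleton.elim (α := Fin 1) a b)) hab


/-- Flipping the sign at `x` negates the sum when `x ≠ y`. -/
theorem sum_sign_mul_sign {I : Type} [Fintype I] [DecidableEq I] (x y : I) :
    ∑ s : I → ℤˣ, (((s x : ℤ) : ℂ) * ((s y : ℤ) : ℂ)) =
      if x = y then (Fintype.card (I → ℤˣ) : ℂ) else 0 := by
  split_ifs with hxy
  · subst hxy
    have : ∀ s : I → ℤˣ, (((s x : ℤ) : ℂ) * ((s x : ℤ) : ℂ)) = 1 := fun s => by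
      rw [← Int.cast_mul, ← Units.val_mul, Int.units_mul_self]; simp
    simp [this]
  · have h := Equiv.sum_comp (Equiv.mulRight (Pi.mulSingle x (-1) : I → ℤˣ))
      (fun s => (((s x : ℤ) : ℂ) * ((s y : ℤ) : ℂ)))
    simp only [Equiv.coe_mulRight, Pi.mul_apply, Pi.mulSingle_eq_same,
      Pi.mulSingle_eq_of_ne (Ne.symm hxy), mul_one] at h
    simp only [mul_neg, mul_one, Units.val_neg, Int.cast_neg, neg_mul, Finset.sum_neg_distrib] at h
    exact self_eq_neg.1 h.symm

/-- Every nc-graph lies below the nc-graph of an edgeless graph, by measuring a tight frame of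
maximally entangled states. -/
theorem exists_EALe_edgeless (S : NCGraph) [Nonempty S.Idx] :
    ∃ (K : Type) (_ : Fintype K) (_ : DecidableEq K), EALe S (ofGraph ⟨K, ⊥⟩) := by
  set d := Fintype.card S.Idx
  have : NeZero d := ⟨Fintype.card_ne_zero⟩
  let e : S.Idx ≃ Fin d := Fintype.equivFin _
  let K := Fin d × (S.Idx → ℤˣ)
  let c : ℝ := (Real.sqrt (Fintype.card (S.Idx → ℤˣ)))⁻¹
  have hc : (c : ℂ) * c * (Fintype.card (S.Idx → ℤˣ) : ℂ) = 1 := by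
    have h0 : (0 : ℝ) < Fintype.card (S.Idx → ℤˣ) := by exact_mod_cast Fintype.card_pos
    have : c * c * (Fintype.card (S.Idx → ℤˣ) : ℝ) = 1 := by
      simp only [c]
      rw [← mul_inv, Real.mul_self_sqrt h0.le, inv_mul_cancel₀ h0.ne']
    exact_mod_cast this
  -- The frame vectors are `c ∑ₓ s(x) |x, e x + a⟩`, indexed by a cyclic shift `a` and a sign
  -- pattern `s`. Averaging over signs kills coherences, the shifts cover all basis vectors, and `c`
  -- makes the frame operator the identity.
  let φ : K → S.Idx × Fin d → ℂ :=
    fun k p => if p.2 = e p.1 + k.1 then c * ((k.2 p.1 : ℤ) : ℂ) else 0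
  have hstar : ∀ k p, star (φ k p) = φ k p := by
    intro k p
    by_cases h : p.2 = e p.1 + k.1 <;> simp [φ, h]
  -- The operator `|k⟩⟨φ_k|` records the measurement outcome; conjugation is invisible because the
  -- entries are real.
  let E : K → Matrix K (S.Idx × Fin d) ℂ := fun k => Matrix.of fun k' p => if k' = k then φ k p else 0
  have hE : ∀ i j (Z : Matrix K K ℂ) p q, ((E i)ᴴ * Z * E j) p q = φ i p * Z i j * φ j q := by
    intro i j Z p q
    simp [E, Matrix.mul_apply, apply_ite, hstar]
  refine ⟨K, inferInstance, inferInstance, EALe_intro ((d : ℂ)⁻¹ • (1 : Matrix (Fin d) (Fin d) ℂ))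
    E ?_ ?_ ?_ ?_⟩
  · refine Matrix.PosDef.one.smul ?_
    have hd0 : (0 : ℂ) < d := by exact_mod_cast NeZero.pos d
    exact inv_pos.2 hd0
  · rw [Matrix.trace_smul, Matrix.trace_one, Fintype.card_fin, smul_eq_mul, inv_mul_cancel₀]
    exact Nat.cast_ne_zero.2 (NeZero.ne d)
  · have h1 : ∀ k p q, ((E k)ᴴ * E k) p q = φ k p * φ k q := by
      intro k p q
      simp [E, Matrix.mul_apply, apply_ite, hstar]
    ext ⟨x, y⟩ ⟨x', y'⟩
    simp only [Matrix.sum_apply, h1, K, Fintype.sum_prod_type, φ]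
    have h2 : ∀ a : Fin d, ∑ s : S.Idx → ℤˣ, ((if y = e x + a then c * ((s x : ℤ) : ℂ) else 0) *
        (if y' = e x' + a then c * ((s x' : ℤ) : ℂ) else 0)) =
        if y - e x = a then (if y' - e x' = a then (if x = x' then 1 else 0) else 0) else 0 := by
      intro a
      simp only [sub_eq_iff_eq_add']
      split_ifs with h h' hx
      · subst hx
        rw [← hc, mul_assoc]
        have := sum_sign_mul_sign x x
        rw [if_pos rfl] at this
        rw [← this, Finset.mul_sum, Finset.mul_sum]
        exact Finset.sum_congr rfl fun s _ => by ring
      · have := sum_sign_mul_sign x x'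
        rw [if_neg hx] at this
        rw [← mul_zero ((c : ℂ) * c), ← this, Finset.mul_sum]
        exact Finset.sum_congr rfl fun s _ => by ring
      all_goals simp
    rw [Finset.sum_congr rfl fun a _ => h2 a, Finset.sum_ite_eq, if_pos (Finset.mem_univ _)]
    by_cases hx : x = x'
    · subst hx
      simp [Matrix.one_apply, eq_comm]
    · simp [hx]
  · intro i j Z hZ
    by_cases hij : i = j
    · subst hij
      -- Maximal entanglement makes the reduced operator scalar, and `1` is the only element that
      -- every nc-graph is guaranteed to contain, up to scalars.
      convert S.space.smul_mem ((d : ℂ)⁻¹ * Z i i * (c * c)) S.one_mem using 1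
      have hφ : ∀ a b, ∑ k, φ i (a, k) * φ i (b, k) = if a = b then (c : ℂ) * c else 0 := by
        intro a b
        by_cases hab : a = b
        · subst hab
          have : (((i.2 a : ℤ) : ℂ) * ((i.2 a : ℤ) : ℂ)) = 1 := by
            rw [← Int.cast_mul, ← Units.val_mul, Int.units_mul_self]; simp
          simp only [φ, mul_ite, mul_zero, Finset.sum_ite_eq', Finset.mem_univ, if_true]
          linear_combination (c : ℂ) * c * this
        · simp [φ, hab, Ne.symm hab]
      ext a b
      rw [Matrix.smul_apply, Matrix.one_apply, smul_eq_mul, mul_assoc, mul_ite, mul_one, mul_zero,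
        ← hφ]
      simp [weightedPartialTrace_apply, hE, Matrix.one_apply, Finset.mul_sum]
      exact Finset.sum_congr rfl fun k _ => by ring
    · convert S.space.zero_mem using 1
      have : Z i j = 0 := mem_graphSpace.1 hZ i j (by simpa using hij)
      ext a b
      simp [weightedPartialTrace_apply, hE, this]

end NCGraph

/-! ### The Strassen axioms on isomorphism classes -/

namespace NCGraphClass

open NCGraph

theorem natCast_eq_mk (K : Type) [Fintype K] [DecidableEq K] :
    ((Fintype.card K : ℕ) : GraphClass) = Quotient.mk _ (⟨K, ⊥⟩ : FinGraph) := by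
  have h : ∀ n : ℕ, (n : GraphClass) = Quotient.mk _ (FinGraph.edgeless n) := by
    intro n
    induction n with
    | zero => exact Nat.cast_zero
    | succ n ih =>
      rw [Nat.cast_succ, ih]
      refine Quotient.sound ⟨⟨finSumFinEquiv, ?_⟩⟩
      rintro (a | a) (b | b) <;> simp
  rw [h]
  exact Quotient.sound ⟨⟨(Fintype.equivFin K).symm, by simp⟩⟩

theorem mk_eq_zero (S : NCGraph) [IsEmpty S.Idx] :
    @Eq NCGraphClass (Quotient.mk _ S) 0 := by
  have : IsEmpty (diag 0).Idx := ⟨fun p => Fin.elim0 p⟩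
  refine Quotient.sound (a := S) (b := diag 0)
    (isom_of_equiv (Equiv.equivOfIsEmpty _ _) (fun X _ => ?_) fun X _ => ?_)
  · convert Submodule.zero_mem _ using 1
    ext a
    exact this.elim a
  · convert Submodule.zero_mem _ using 1
    ext a
    exact isEmptyElim a

/-- The homomorphism `ψ` supplies the one axiom that is not constructive: a relation between natural
numbers pulls back to graphs, where `ψ` evaluates it as an inequality of numbers. -/
theorem isStrassen {ψ : GraphClass →+* ℝ≥0}
    (hψ : ∀ x y, EALe (graphToNC x) (graphToNC y) → ψ x ≤ ψ y) : IsStrassen EALe where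
  refl a := Quotient.inductionOn a EALe_refl
  trans {a b c} := Quotient.inductionOn₃ a b c fun _ _ _ => EALe_trans
  add_right {a b} hab c := by
    revert hab
    exact Quotient.inductionOn₃ a b c fun _ _ T h => EALe_directSum h T
  mul_right {a b} hab c := by
    revert hab
    exact Quotient.inductionOn₃ a b c fun _ _ T h => EALe_tensor h T
  zero_le a := Quotient.inductionOn a zero_EALe
  one_le {a} := by
    refine Quotient.inductionOn a fun S hS => ?_
    by_cases hne : Nonempty S.Idx
    · exact one_EALe S
    · rw [not_nonempty_iff] at hne
      exact absurd (mk_eq_zero S) hS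
  exists_le_nat a := by
    refine Quotient.inductionOn a fun S => ?_
    by_cases hne : Nonempty S.Idx
    · obtain ⟨K, _, _, hK⟩ := exists_EALe_edgeless S
      refine ⟨Fintype.card K, ?_⟩
      rw [← map_natCast graphToNC, natCast_eq_mk]
      exact hK
    · rw [not_nonempty_iff] at hne
      refine ⟨0, ?_⟩
      rw [mk_eq_zero S, Nat.cast_zero]
      exact zero_EALe (diag 0)
  nat_le {n m} h := by
    have := hψ n m (by simpa using h)
    simpa using this

end NCGraphClass

/-! ## The preorder on graphs is the restriction of the preorder on nc-graphs -/

namespace NCGraph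

/-! ### Gram matrices and supports -/

open scoped MatrixOrder in
theorem exists_eq_conjTranspose_mul_self {n : Type} [Fintype n] [DecidableEq n]
    {A : Matrix n n ℂ} (hA : A.PosSemidef) : ∃ B : Matrix n n ℂ, A = Bᴴ * B :=
  CStarAlgebra.nonneg_iff_eq_star_mul_self.mp hA.nonneg

theorem trace_conjTranspose_mul_self_nonneg {m n : Type} [Fintype m] [Fintype n]
    (A : Matrix m n ℂ) : 0 ≤ (Aᴴ * A).trace :=
  (Matrix.posSemidef_conjTranspose_mul_self A).trace_nonneg

theorem eq_zero_of_sum_conjTranspose_mul_self {m n ι : Type} [Fintype m] [Fintype n] [Fintype ι]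
    {A : ι → Matrix m n ℂ} (h : ∑ i, (A i)ᴴ * A i = 0) (i : ι) : A i = 0 := by
  have h₁ : ∑ i, ((A i)ᴴ * A i).trace = 0 := by rw [← Matrix.trace_sum, h, Matrix.trace_zero]
  rw [Finset.sum_eq_zero_iff_of_nonneg fun i _ => trace_conjTranspose_mul_self_nonneg (A i)] at h₁
  exact Matrix.trace_conjTranspose_mul_self_eq_zero_iff.1 (h₁ i (Finset.mem_univ i))

/-- If the Gram matrices of `A` and `B` are orthogonal then so are the rows of `A` and `B`. -/
theorem mul_conjTranspose_eq_zero {l m n : Type} [Fintype l] [Fintype m] [Fintype n]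
    {A : Matrix l n ℂ} {B : Matrix m n ℂ} (h : (Aᴴ * A) * (Bᴴ * B) = 0) : A * Bᴴ = 0 := by
  rw [← Matrix.trace_conjTranspose_mul_self_eq_zero_iff, Matrix.conjTranspose_mul,
    Matrix.conjTranspose_conjTranspose, Matrix.mul_assoc, Matrix.trace_mul_comm]
  have : Aᴴ * (A * Bᴴ) * B = (Aᴴ * A) * (Bᴴ * B) := by simp only [Matrix.mul_assoc]
  rw [this, h, Matrix.trace_zero]

/-- The spectral decomposition of a positive semidefinite matrix, restricted to its support. -/
theorem exists_support_decomposition {n : Type} [Fintype n] [DecidableEq n] {ρ : Matrix n n ℂ}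
    (hρ : ρ.PosSemidef) : ∃ (κ : Type) (_ : Fintype κ) (_ : DecidableEq κ) (V : Matrix n κ ℂ)
      (D : κ → ℝ), (∀ k, 0 < D k) ∧ Vᴴ * V = 1 ∧
      ρ = V * Matrix.diagonal (fun k => (D k : ℂ)) * Vᴴ := by
  classical
  let U : Matrix n n ℂ := hρ.isHermitian.eigenvectorUnitary
  have hU : Uᴴ * U = 1 := Unitary.coe_star_mul_self hρ.isHermitian.eigenvectorUnitary
  let κ := {i // hρ.isHermitian.eigenvalues i ≠ 0}
  refine ⟨κ, inferInstance, inferInstance, U.submatrix id Subtype.val,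
    fun k => hρ.isHermitian.eigenvalues k.1, fun k => ?_, ?_, ?_⟩
  · exact lt_of_le_of_ne (hρ.eigenvalues_nonneg _) k.2.symm
  · rw [Matrix.conjTranspose_submatrix, ← Matrix.submatrix_mul _ _ _ id _ Function.bijective_id, hU]
    exact Matrix.submatrix_one _ Subtype.val_injective
  · have h₁ : ρ = U * Matrix.diagonal (fun i => (hρ.isHermitian.eigenvalues i : ℂ)) * Uᴴ :=
      hρ.isHermitian.spectral_theorem
    ext a b
    conv_lhs => rw [h₁]
    simp only [Matrix.mul_apply (M := _ * _), Matrix.mul_diagonal, Matrix.submatrix_apply, id,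
      Matrix.conjTranspose_apply]
    rw [← Finset.sum_filter_of_ne (p := fun i => hρ.isHermitian.eigenvalues i ≠ 0)]
    · exact Finset.sum_subtype _ (by simp) _
    · intro i _ hi h0
      simp [h0] at hi

/-- Testing the preorder on the matrix units of `S_H` turns it into orthogonality, weighted by `ρ`,
of the blocks `⟨h|E_i|g⟩`. A factorisation `ρ = Bᴴ * B` absorbs the weight. -/
theorem EAHom_of_EALe_ofGraph {G H : FinGraph} (h : EALe (ofGraph G) (ofGraph H)) :
    FinGraph.EALe G H := by
  obtain ⟨d, ρ, n, E, hρ, htr, hE, hle⟩ := EALe_elim h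
  obtain ⟨B, hB⟩ : ∃ B : Matrix (Fin d) (Fin d) ℂ, ρ = Bᴴ * B :=
    exists_eq_conjTranspose_mul_self hρ.posSemidef
  let W : Fin n → G.V → H.V → Matrix Unit (Fin d) ℂ := fun i g h => Matrix.of fun _ k => E i h (g, k)
  have hWρ : ∀ i j g g' h h', (g' ≠ g ∧ ¬ G.graph.Adj g' g) → (h' = h ∨ H.graph.Adj h' h) →
      W i g h * ρ * (W j g' h')ᴴ = 0 := by
    intro i j g g' h h' hg hh
    have hZ : Matrix.single h' h (1 : ℂ) ∈ (ofGraph H).space :=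
      Submodule.subset_span ⟨h', h, hh, rfl⟩
    have := mem_graphSpace.1 (hle j i _ hZ) g' g (by tauto)
    ext
    rw [Matrix.zero_apply, ← this]
    have hM : ∀ k l, ((E j)ᴴ * Matrix.single h' h (1 : ℂ) * E i) (g', k) (g, l) =
        star (E j h' (g', k)) * E i h (g, l) := by
      intro k l
      rw [Matrix.mul_assoc, Matrix.mul_apply, Finset.sum_eq_single h']
      · simp
      · intro b _ hb
        simp [hb]
      · simp
    simp only [weightedPartialTrace_apply, hM, Matrix.mul_apply, Matrix.conjTranspose_apply, W,
      Matrix.of_apply, Finset.sum_mul]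
    exact Finset.sum_congr rfl fun k _ => Finset.sum_congr rfl fun l _ => by ring
  -- With `σ_g^h = B (∑ᵢ Wᵢᴴ Wᵢ) Bᴴ`, completeness of the Kraus operators gives the common sum `B *
  -- Bᴴ`, and the middle of a product of two such terms is `Wᵢ ρ Wⱼᴴ`.
  refine ⟨d, B * Bᴴ, fun g h => ∑ i, (W i g h * Bᴴ)ᴴ * (W i g h * Bᴴ),
    Matrix.posSemidef_self_mul_conjTranspose B, ?_, fun g h =>
      Matrix.posSemidef_sum _ fun i _ => Matrix.posSemidef_conjTranspose_mul_self _, ?_, ?_⟩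
  · intro h0
    have : (B * Bᴴ).trace = 1 := by rw [Matrix.trace_mul_comm, ← hB, htr]
    rw [h0, Matrix.trace_zero] at this
    exact zero_ne_one this
  · intro g
    have h₁ : ∑ h, ∑ i, (W i g h)ᴴ * W i g h = 1 := by
      ext k l
      have := congrFun (congrFun hE (g, k)) (g, l)
      simp only [Matrix.sum_apply, Matrix.mul_apply, Matrix.conjTranspose_apply] at this
      rw [Finset.sum_comm] at this
      simpa [Matrix.sum_apply, Matrix.mul_apply, W, Matrix.one_apply] using this
    have h₂ : ∀ i h, (W i g h * Bᴴ)ᴴ * (W i g h * Bᴴ) = B * ((W i g h)ᴴ * W i g h) * Bᴴ := by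
      intro i h
      simp only [Matrix.conjTranspose_mul, Matrix.conjTranspose_conjTranspose, Matrix.mul_assoc]
    simp only [h₂, ← Matrix.sum_mul, ← Matrix.mul_sum, h₁, Matrix.mul_one]
  · intro g g' h h' hg hh
    rw [Matrix.sum_mul]
    refine Finset.sum_eq_zero fun i _ => ?_
    rw [Matrix.mul_sum]
    refine Finset.sum_eq_zero fun j _ => ?_
    have h₁ : W i g h * Bᴴ * (W j g' h' * Bᴴ)ᴴ = 0 := by
      rw [SimpleGraph.compl_adj] at hg hh
      rw [← hWρ i j g g' h h' ⟨hg.1.symm, fun h => hg.2 h.symm⟩ (by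
        rw [H.graph.adj_comm, eq_comm]; tauto), hB]
      simp only [Matrix.conjTranspose_mul, Matrix.conjTranspose_conjTranspose, Matrix.mul_assoc]
    rw [Matrix.mul_assoc, ← Matrix.mul_assoc (W i g h * Bᴴ), h₁, Matrix.zero_mul, Matrix.mul_zero]

/-- The nc-graph relation needs a positive definite ancilla, so everything is compressed to the
support of `ρ`. Nothing is lost, since each `σ g h` is supported there. -/
theorem EALe_ofGraph_of_EAHom {G H : FinGraph} (h : FinGraph.EALe G H) :
    EALe (ofGraph G) (ofGraph H) := by
  obtain ⟨d, ρ, σ, hρ, hρ0, hσ, hsum, horth⟩ := h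
  obtain ⟨κ, _, _, V, D, hD, hV, hVD⟩ := exists_support_decomposition hρ
  choose C hC using fun g h => exists_eq_conjTranspose_mul_self (hσ g h)
  have hCV : ∀ g h, C g h * (V * Vᴴ) = C g h := by
    intro g h
    have h₁ : Vᴴ * (1 - V * Vᴴ) = 0 := by
      rw [Matrix.mul_sub, ← Matrix.mul_assoc, hV, Matrix.mul_one, Matrix.one_mul, sub_self]
    -- Compressing `∑ σ = ρ` to the kernel of `ρ` gives zero, so every positive summand vanishes
    -- there.
    have h₂ : ∑ h, (C g h * (1 - V * Vᴴ))ᴴ * (C g h * (1 - V * Vᴴ)) = 0 := by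
      have : ∀ h, (C g h * (1 - V * Vᴴ))ᴴ * (C g h * (1 - V * Vᴴ)) =
          (1 - V * Vᴴ)ᴴ * σ g h * (1 - V * Vᴴ) := by
        intro h
        rw [hC, Matrix.conjTranspose_mul]
        simp only [Matrix.mul_assoc]
      simp only [this, ← Matrix.sum_mul, ← Matrix.mul_sum, hsum]
      rw [hVD, Matrix.mul_assoc, Matrix.mul_assoc, h₁, Matrix.mul_zero, Matrix.mul_zero]
    have h₃ := eq_zero_of_sum_conjTranspose_mul_self h₂ h
    rw [Matrix.mul_sub, Matrix.mul_one, sub_eq_zero] at h₃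
    exact h₃.symm
  have : Nonempty κ := by
    by_contra hne
    rw [not_nonempty_iff] at hne
    refine hρ0 ?_
    rw [hVD]
    ext a b
    simp [Matrix.mul_apply]
  set τ : ℝ := ∑ k, D k
  have hτ : 0 < τ := Finset.sum_pos (fun k _ => hD k) Finset.univ_nonempty
  -- This is `D^{-1/2}`: it normalises the measurement operators `C V Q`, and it cancels against
  -- `ρ'` up to `τ⁻¹` in the orthogonality relations.
  let Q : Matrix κ κ ℂ := Matrix.diagonal fun k => (((Real.sqrt (D k))⁻¹ : ℝ) : ℂ)
  have hQ : Qᴴ = Q := by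
    simp [Q, Matrix.diagonal_conjTranspose, Pi.star_def]
  have hQD : Q * Matrix.diagonal (fun k => (D k : ℂ)) * Q = 1 := by
    simp only [Q, Matrix.diagonal_mul_diagonal]
    rw [← Matrix.diagonal_one]
    congr 1
    ext k
    have h₁ := Real.sqrt_pos.2 (hD k)
    have h₂ : (√(D k))⁻¹ * D k * (√(D k))⁻¹ = 1 := by
      nth_rw 2 [← Real.mul_self_sqrt (hD k).le]
      field_simp
    exact_mod_cast h₂
  let ρ' : Matrix κ κ ℂ := (τ⁻¹ : ℂ) • Matrix.diagonal (fun k => (D k : ℂ))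
  have hQρ : Q * ρ' * Q = (τ⁻¹ : ℂ) • 1 := by
    rw [Matrix.mul_smul, Matrix.smul_mul, hQD]
  let K : G.V → H.V → Matrix (Fin d) κ ℂ := fun g h => C g h * V * Q
  have hKK : ∀ g, ∑ h, (K g h)ᴴ * K g h = 1 := by
    intro g
    have : ∀ h, (K g h)ᴴ * K g h = (V * Q)ᴴ * σ g h * (V * Q) := by
      intro h
      rw [hC]
      simp only [K, Matrix.conjTranspose_mul, Matrix.mul_assoc]
    simp only [this, ← Matrix.sum_mul, ← Matrix.mul_sum, hsum]
    rw [hVD, Matrix.conjTranspose_mul, hQ, ← hQD]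
    calc _ = Q * (Vᴴ * V) * Matrix.diagonal (fun k => (D k : ℂ)) * (Vᴴ * V) * Q := by
          simp only [Matrix.mul_assoc]
      _ = _ := by rw [hV, Matrix.mul_one, Matrix.mul_one]
  have hKρ : ∀ g h g' h', σ g' h' * σ g h = 0 → K g' h' * ρ' * (K g h)ᴴ = 0 := by
    intro g h g' h' h0
    rw [hC, hC] at h0
    have h₁ := mul_conjTranspose_eq_zero h0
    calc K g' h' * ρ' * (K g h)ᴴ = C g' h' * V * (Q * ρ' * Q) * Vᴴ * (C g h)ᴴ := by
          simp only [K, Matrix.conjTranspose_mul, Matrix.mul_assoc, hQ]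
      _ = (τ⁻¹ : ℂ) • ((C g' h' * (V * Vᴴ)) * (C g h)ᴴ) := by
          rw [hQρ]; simp [Matrix.mul_assoc]
      _ = 0 := by rw [hCV, h₁, smul_zero]
  -- Read the vertex `g`, measure the ancilla with `K g`, and output `h`; the index `m` splits `K g
  -- h` into its rows.
  let E : G.V × H.V × Fin d → Matrix H.V (G.V × κ) ℂ := fun i =>
    Matrix.of fun x p => if x = i.2.1 then if p.1 = i.1 then K i.1 i.2.1 i.2.2 p.2 else 0 else 0
  refine EALe_intro ρ' E ?_ ?_ ?_ ?_
  · refine Matrix.PosDef.smul ?_ ?_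
    · exact Matrix.PosDef.diagonal fun k => by exact_mod_cast hD k
    · have : (0 : ℂ) < τ := by exact_mod_cast hτ
      exact inv_pos.2 this
  · rw [Matrix.trace_smul, Matrix.trace_diagonal, smul_eq_mul, ← Complex.ofReal_sum]
    exact inv_mul_cancel₀ (by exact_mod_cast hτ.ne')
  · ext ⟨a, k⟩ ⟨b, l⟩
    have h₁ : ∀ g h m, ((E (g, h, m))ᴴ * E (g, h, m)) (a, k) (b, l) =
        if a = g then if b = g then star (K g h m k) * K g h m l else 0 else 0 := by
      intro g h m
      by_cases ha : a = g <;> by_cases hb : b = g <;> simp [E, Matrix.mul_apply, ha, hb, apply_ite]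
    have h₂ : ∑ h, ∑ m, star (K a h m k) * K a h m l = (1 : Matrix κ κ ℂ) k l := by
      rw [← hKK a]
      simp [Matrix.sum_apply, Matrix.mul_apply]
    simp only [Matrix.sum_apply, Fintype.sum_prod_type, h₁]
    rw [Finset.sum_eq_single a (by intro g _ hg; simp [hg.symm]) (by simp)]
    by_cases hab : b = a
    · subst hab
      simp only [if_true, h₂, Matrix.one_apply, Prod.mk.injEq, true_and]
    · simp [hab, Ne.symm hab]
  · rintro ⟨g, h, m⟩ ⟨g', h', m'⟩ Z hZ
    refine mem_graphSpace.2 fun a b hab => ?_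
    have h₁ : ∀ k l, ((E (g, h, m))ᴴ * Z * E (g', h', m')) (a, k) (b, l) =
        if a = g then if b = g' then star (K g h m k) * Z h h' * K g' h' m' l else 0 else 0 := by
      intro k l
      by_cases ha : a = g <;> by_cases hb : b = g' <;> simp [E, Matrix.mul_apply, ha, hb, apply_ite]
    simp only [weightedPartialTrace_apply, h₁]
    by_cases hag : a = g
    · by_cases hbg : b = g'
      · subst hag hbg
        -- The entry is `Z h h'` times an entry of `K_b^{h'} ρ' (K_a^h)ᴴ`. One factor vanishes in
        -- each case: the second by orthogonality if `h`, `h'` are equal or adjacent, and the first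
        -- otherwise.
        by_cases hh : h = h' ∨ H.graph.Adj h h'
        · push Not at hab
          have h₂ := congrFun (congrFun (hKρ a h b h' (horth b a h' h
            ⟨Ne.symm hab.1, fun hc => hab.2 hc.symm⟩ fun hc => ?_)) m') m
          · simp only [if_true]
            rw [Matrix.zero_apply] at h₂
            rw [← mul_zero (Z h h'), ← h₂]
            simp only [Matrix.mul_apply, Matrix.conjTranspose_apply, Finset.mul_sum,
              Finset.sum_mul]
            exact Finset.sum_congr rfl fun k _ => Finset.sum_congr rfl fun l _ => by ring
          · rcases hh with hh | hh
            · exact hc.1 hh.symm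
            · exact hc.2 hh.symm
        · have hZ0 : Z h h' = 0 := mem_graphSpace.1 hZ h h' hh
          simp [hZ0]
      · simp [hbg]
    · simp [hag]

theorem EALe_ofGraph_iff {G H : FinGraph} :
    EALe (ofGraph G) (ofGraph H) ↔ FinGraph.EALe G H :=
  ⟨EAHom_of_EALe_ofGraph, EALe_ofGraph_of_EAHom⟩

end NCGraph

/-! ### Conclusion for the asymptotic spectra -/

theorem graphToNC_EALe_iff (x y : GraphClass) :
    NCGraphClass.EALe (graphToNC x) (graphToNC y) ↔ GraphClass.EALe x y :=
  Quotient.inductionOn₂ x y fun _ _ => NCGraph.EALe_ofGraph_iff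

/-- Restriction along `ι` is a well-defined and surjective map from the asymptotic spectrum of
nc-graphs to the asymptotic spectrum of graphs, both with respect to the entanglement-assisted
cohomomorphism preorder. -/
theorem mainTheorem9 :
    ∃ h : Set.MapsTo (fun φ : NCGraphClass →+* ℝ≥0 => φ.comp graphToNC)
        (asymptoticSpectrum NCGraphClass NCGraphClass.EALe)
        (asymptoticSpectrum GraphClass GraphClass.EALe),
      Function.Surjective h.restrict := by
  refine ⟨fun φ hφ x y hxy => hφ _ _ ((graphToNC_EALe_iff x y).2 hxy), ?_⟩
  rintro ⟨ψ, hψ⟩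
  have hψ' : ∀ x y, NCGraphClass.EALe (graphToNC x) (graphToNC y) → ψ x ≤ ψ y :=
    fun x y hxy => hψ x y ((graphToNC_EALe_iff x y).1 hxy)
  obtain ⟨φ, hφ, hφψ⟩ := (NCGraphClass.isStrassen hψ').exists_comp_eq graphToNC ψ hψ'
  exact ⟨⟨φ, hφ⟩, Subtype.ext hφψ⟩
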